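/- \textbf{Setting.} Let $A, B_w, B_n, B_r$, $C_z, D_{zw}, D_{zn}, D_{zr}$, $C_e, D_{ew}, D_{en}, D_{er}$, $C_y, D_{yw}, D_{yn}, D_{yr}$ be real matrices of compatible sizes and consider the discrete-time interconnection $$\begin{pmatrix} x(k+1)\\ z(k)\\ e(k)\\ y(k)\end{pmatrix}=\begin{pmatrix} A&B_w&B_n&B_r\\ C_z&D_{zw}&D_{zn}&D_{zr}\\ C_e&D_{ew}&D_{en}&D_{er}\\ C_y&D_{yw}&D_{yn}&D_{yr}\end{pmatrix}\begin{pmatrix} x(k)\\ w(k)\\ n(k)\\ r(k)\end{pmatrix},\qquad w(k)=\Delta_* z(k),\tag{1}$$ with a constant $\Delta_*\in\mathbf\Delta\subset\mathbb R^{n_w\times n_z}$. Put $d=\binom{n}{r}$, $B_d=(B_n\ B_r)$, $D_{zd}=(D_{zn}\ D_{zr})$, $D_{ed}=(D_{en}\ D_{er})$. The interconnection is \emph{stable} if $I-D_{zw}\Delta_*$ is nonsingular and there are $M,\alpha>0$ with $\|x(t)\|\le Me^{-\alpha t}\|x(0)\|$ for all $t\ge 0$ and all trajectories of (1) with $d=0$.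 Its \emph{energy gain} is $\sup\{\|e\|_{\ell_2}/\|d\|_{\ell_2} : d\in\ell_2\setminus\{0\},\ x(0)=0\}$. A set $\mathbf P$ of symmetric matrices of size $q+p$ is a \emph{multiplier set} for a set $\mathbf U\subset\mathbb R^{p\times q}$ if $\binom{-U^\top}{I}^\top P\binom{-U^\top}{I}\preccurlyeq 0$ for all $U\in\mathbf U$, $P\in\mathbf P$, and $\mathbf P=\{E(\nu):\nu\in\mathbb R^{m},\ F(\nu)\succ 0\}$ for some $m$ and some affine maps $E,F$ with symmetric matrix values. For $l\ge 1$, $i\in\{w,n,r,d\}$, $o\in\{z,e,y\}$ let $\hat B_{li}=(A^{l-1}B_i\ \cdots\ AB_i\ \ B_i)$, let $\hat C_{lo}$ be the block column with blocks $C_o, C_oA,\dots,C_oA^{l-1}$, and let $\hat D_{loi}$ be the $l\times l$ block lower triangular matrix with blocks $D_{oi}$ on the diagonal and $C_oA^{j-k-1}B_i$ in position $(j,k)$ for $j>k$. \textbf{Data.} Let $h\in\mathbb N$, $x_*\in\mathbb R^{n}$ and let $n_*,r_*,y_*$ be vertically stacked sequences of length $h$ such that (1) has a trajectory on $k=0,\dots,h-1$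 with $x(0)=x_*$, noise $n_*$, input $r_*$ and measured output $y_*$. Let $\mathbf P$ be a multiplier set for $\mathbf\Delta$, let $\mathbf P_n$ be a multiplier set for $\{n_*\}$, where $n_*$ is regarded as a matrix with one column, and put $$\mathbf P_{\mathcal D}=\left\{T^\top P_nT : P_n\in\mathbf P_n\right\},\qquad T=\begin{pmatrix} y_*&0\\ x_*&0\\ 0&I\\ r_*&0\end{pmatrix}^{\!\top}\begin{pmatrix}0&I\\ -\hat C_{hz}^\top&-\hat C_{hy}^\top\\ -\hat D_{hzn}^\top&-\hat D_{hyn}^\top\\ -\hat D_{hzr}^\top&-\hat D_{hyr}^\top\end{pmatrix}.$$ Let $\sigma\in\{1,\dots,h\}$ be such that $\ker\hat D_{hyw}\subset\ker(\hat B_{\sigma w}\ \,0)$ and $\ker\hat D_{hyw}\subset\ker(\hat D_{\sigma ew}\ \,0)$, where the zero blocks have $(h-\sigma)n_w$ columns. With the Moore--Penrose inverse $\hat D_{hyw}^+$ put $M_b=(\hat B_{\sigma w}\ \,0)\hat D_{hyw}^+$, $M_d=(\hat D_{\sigma ew}\ \,0)\hat D_{hyw}^+$, and put $N=(I_{\sigma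 n_z}\ \,0)$ with $hn_z$ columns. For $\gamma>0$ let $P_\gamma=\begin{pmatrix}I&0\\0&-\gamma^2I\end{pmatrix}$, with blocks of sizes $\sigma n_e$ and $\sigma n_d$. \textbf{Theorem.} Suppose that there exist $X\succ 0$, $P=\begin{pmatrix}Q&S\\S^\top&R\end{pmatrix}\in\mathbf P$ (with $Q$ of size $n_z$) and $P_{\mathcal D}\in\mathbf P_{\mathcal D}$ such that, with $\hat P=\begin{pmatrix}I_\sigma\otimes Q&I_\sigma\otimes S\\ I_\sigma\otimes S^\top&I_\sigma\otimes R\end{pmatrix}$, $$L^\top\,\mathrm{diag}\big(X,\,-X,\,\hat P,\,P_{\mathcal D},\,P_\gamma^{-1}\big)\,L\succ 0,\qquad L=\begin{pmatrix} I&0&0\\ -(A^\sigma)^\top&-\hat C_{\sigma z}^\top&-\hat C_{\sigma e}^\top\\ 0&I&0\\ -\hat B_{\sigma w}^\top&-\hat D_{\sigma zw}^\top&-\hat D_{\sigma ew}^\top\\ 0&N^\top&0\\ M_b^\top&0&M_d^\top\\ 0&0&I\\ -\hat B_{\sigma d}^\top&-\hat D_{\sigma zd}^\top&-\hat D_{\sigma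 ed}^\top\end{pmatrix}.$$ Then the interconnection (1) is stable and its energy gain is at most $\gamma$. -/

import Mathlib

open scoped Matrix Kronecker ENNReal

/-! ### The Moore-Penrose inverse of a real matrix -/

/-- `B` satisfies the four Penrose equations for the real matrix `A`. -/
structure IsMoorePenroseInverse {m n : Type*} [Fintype m] [Fintype n]
    (A : Matrix m n ℝ) (B : Matrix n m ℝ) : Prop where
  mul_mul_self : A * B * A = A
  inv_mul_mul : B * A * B = B
  left_symm : (A * B)ᵀ = A * B
  right_symm : (B * A)ᵀ = B * A

theorem IsMoorePenroseInverse.unique {m n : Type*} [Fintype m] [Fintype n]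
    {A : Matrix m n ℝ} {B C : Matrix n m ℝ}
    (hB : IsMoorePenroseInverse A B) (hC : IsMoorePenroseInverse A C) : B = C := by
  have h1 : A * B = A * C := by
    calc A * B = (A * C * A) * B := by rw [hC.mul_mul_self]
      _ = (A * C) * (A * B) := by simp only [Matrix.mul_assoc]
      _ = (A * C)ᵀ * (A * B)ᵀ := by rw [hC.left_symm, hB.left_symm]
      _ = ((A * B * A) * C)ᵀ := by rw [← Matrix.transpose_mul]; simp only [Matrix.mul_assoc]
      _ = A * C := by rw [hB.mul_mul_self, hC.left_symm]
  have h2 : B * A = C * A := by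
    calc B * A = B * (A * C * A) := by rw [hC.mul_mul_self]
      _ = (B * A) * (C * A) := by simp only [Matrix.mul_assoc]
      _ = (B * A)ᵀ * (C * A)ᵀ := by rw [hC.right_symm, hB.right_symm]
      _ = (C * (A * B * A))ᵀ := by rw [← Matrix.transpose_mul]; simp only [Matrix.mul_assoc]
      _ = C * A := by rw [hB.mul_mul_self, hC.right_symm]
  calc B = B * A * B := hB.inv_mul_mul.symm
    _ = C * (A * B) := by rw [h2, Matrix.mul_assoc]
    _ = C * A * C := by rw [h1, Matrix.mul_assoc]
    _ = C := hC.inv_mul_mul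

theorem exists_isMoorePenroseInverse {m n : Type*} [Fintype m] [Fintype n]
    (A : Matrix m n ℝ) : ∃ B : Matrix n m ℝ, IsMoorePenroseInverse A B := by
  classical
  have hH : IsSelfAdjoint (Aᵀ * A) := by
    rw [← Matrix.conjTranspose_eq_transpose_of_trivial]
    exact (Matrix.isHermitian_conjTranspose_mul_self A).isSelfAdjoint
  have hcont : ∀ f : ℝ → ℝ, ContinuousOn f (spectrum ℝ (Aᵀ * A)) := fun f =>
    (Matrix.finite_real_spectrum (A := Aᵀ * A)).continuousOn f
  obtain ⟨G, hG⟩ : ∃ G, G = cfc (fun x : ℝ => x⁻¹) (Aᵀ * A) := ⟨_, rfl⟩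
  have hid : Aᵀ * A = cfc (fun x : ℝ => x) (Aᵀ * A) := (cfc_id' ℝ (Aᵀ * A) hH).symm
  have hGs : Gᵀ = G := by
    have : IsSelfAdjoint G := hG ▸ cfc_predicate _ _
    rw [← Matrix.conjTranspose_eq_transpose_of_trivial]
    exact this
  have hGH : G * (Aᵀ * A) = cfc (fun x : ℝ => x⁻¹ * x) (Aᵀ * A) := by
    rw [cfc_mul _ _ _ (hcont _) (hcont _), ← hG, ← hid]
  have hGHs : (G * (Aᵀ * A))ᵀ = G * (Aᵀ * A) := by
    have : IsSelfAdjoint (G * (Aᵀ * A)) := hGH ▸ cfc_predicate _ _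
    rw [← Matrix.conjTranspose_eq_transpose_of_trivial]
    exact this
  have hHGH : Aᵀ * A * (G * (Aᵀ * A)) = Aᵀ * A := by
    have h1 : Aᵀ * A * (G * (Aᵀ * A)) = cfc (fun x : ℝ => x * (x⁻¹ * x)) (Aᵀ * A) := by
      rw [cfc_mul _ _ _ (hcont _) (hcont _), ← hGH, ← hid]
    have h2 : (fun x : ℝ => x * (x⁻¹ * x)) = fun x => x := by
      funext x
      by_cases hx : x = 0
      · simp [hx]
      · field_simp
    rw [h1, h2, ← hid]
  have hGHG : G * (Aᵀ * A) * G = G := by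
    have h1 : G * (Aᵀ * A) * G = cfc (fun x : ℝ => (x⁻¹ * x) * x⁻¹) (Aᵀ * A) := by
      rw [cfc_mul _ _ _ (hcont _) (hcont _), ← hGH, ← hG]
    have h2 : (fun x : ℝ => (x⁻¹ * x) * x⁻¹) = fun x => x⁻¹ := by
      funext x
      by_cases hx : x = 0
      · simp [hx]
      · field_simp
    rw [h1, h2, ← hG]
  have hE : A * (G * (Aᵀ * A)) - A = 0 := by
    rw [← Matrix.conjTranspose_mul_self_eq_zero,
      Matrix.conjTranspose_eq_transpose_of_trivial, Matrix.transpose_sub,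
      Matrix.transpose_mul, hGHs, Matrix.sub_mul, Matrix.mul_sub, Matrix.mul_sub]
    have h3 : Aᵀ * (A * (G * (Aᵀ * A))) = Aᵀ * A := by rw [← Matrix.mul_assoc, hHGH]
    simp only [Matrix.mul_assoc] at *
    rw [h3]
    simp
  refine ⟨G * Aᵀ, ?_, ?_, ?_, ?_⟩
  · rw [sub_eq_zero] at hE
    simpa only [Matrix.mul_assoc] using hE
  · calc G * Aᵀ * A * (G * Aᵀ) = (G * (Aᵀ * A) * G) * Aᵀ := by simp only [Matrix.mul_assoc]
      _ = G * Aᵀ := by rw [hGHG]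
  · simp only [Matrix.transpose_mul, Matrix.transpose_transpose, hGs, Matrix.mul_assoc]
  · simpa only [Matrix.mul_assoc] using hGHs

/-- The Moore-Penrose inverse `A⁺`. -/
noncomputable def moorePenroseInverse {m n : Type*} [Fintype m] [Fintype n]
    (A : Matrix m n ℝ) : Matrix n m ℝ :=
  (exists_isMoorePenroseInverse A).choose

theorem moorePenroseInverse_spec {m n : Type*} [Fintype m] [Fintype n]
    (A : Matrix m n ℝ) : IsMoorePenroseInverse A (moorePenroseInverse A) :=
  (exists_isMoorePenroseInverse A).choose_spec

/-! ### Multiplier sets -/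

/-- The symmetric product `(•)ᵀ P M = Mᵀ P M`. -/
def symProduct {m n : Type*} [Fintype m] (P : Matrix m m ℝ) (M : Matrix m n ℝ) :
    Matrix n n ℝ :=
  M.transpose * P * M

/-- `Ps = {E(ν) : ν ∈ ℝᵖ, F(ν) ≻ 0}` for affine maps `E`, `F` with values in the
symmetric matrices. -/
def HasLMIRepresentation {ι : Type*} (Ps : Set (Matrix ι ι ℝ)) : Prop :=
  ∃ (p q : ℕ) (E : (Fin p → ℝ) →ᵃ[ℝ] Matrix ι ι ℝ)
    (F : (Fin p → ℝ) →ᵃ[ℝ] Matrix (Fin q) (Fin q) ℝ),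
    (∀ ν, (E ν).IsSymm) ∧ (∀ ν, (F ν).IsSymm) ∧ Ps = {P | ∃ ν, (F ν).PosDef ∧ P = E ν}

/-- `Ps` is a (dual) multiplier set for the set of uncertainties `Δs`. -/
def IsMultiplierSet {w z : Type*} [Fintype w] [DecidableEq w] [Fintype z]
    (Δs : Set (Matrix w z ℝ)) (Ps : Set (Matrix (z ⊕ w) (z ⊕ w) ℝ)) : Prop :=
  (∀ P ∈ Ps, P.IsSymm) ∧
  (∀ Δ ∈ Δs, ∀ P ∈ Ps,
    (-symProduct P (Matrix.fromRows (-Δᵀ) (1 : Matrix w w ℝ))).PosSemidef) ∧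
  HasLMIRepresentation Ps

/-! ### Lifted matrices

A signal block of length `h` with entries indexed by `ι` is indexed by `Fin h × ι`. -/

section Lifting

variable {n i o : Type*} [Fintype n] [DecidableEq n]

/-- `(A^(h-1) B, A^(h-2) B, …, B)`. -/
def liftB (h : ℕ) (A : Matrix n n ℝ) (B : Matrix n i ℝ) : Matrix n (Fin h × i) ℝ :=
  Matrix.of fun a jb => (A ^ (h - 1 - (jb.1 : ℕ)) * B) a jb.2

/-- The block column with blocks `C, C A, …, C A^(h-1)`. -/
def liftC (h : ℕ) (A : Matrix n n ℝ) (C : Matrix o n ℝ) : Matrix (Fin h × o) n ℝ :=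
  Matrix.of fun ja b => (C * A ^ (ja.1 : ℕ)) ja.2 b

/-- The block lower triangular block Toeplitz matrix with diagonal blocks `D` and blocks
`C A^(j-k-1) B` at the positions `(j, k)` with `k < j`. -/
def liftD (h : ℕ) (A : Matrix n n ℝ) (B : Matrix n i ℝ) (C : Matrix o n ℝ)
    (D : Matrix o i ℝ) : Matrix (Fin h × o) (Fin h × i) ℝ :=
  Matrix.of fun ja kb =>
    if ja.1 = kb.1 then D ja.2 kb.2
    else if kb.1 < ja.1 then (C * A ^ ((ja.1 : ℕ) - (kb.1 : ℕ) - 1) * B) ja.2 kb.2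
    else 0

end Lifting

/-- `(M, 0)`: append `h - σ` zero block columns to a matrix with `σ` block columns. -/
def padCols {m i : Type*} {σ : ℕ} (h : ℕ) (M : Matrix m (Fin σ × i) ℝ) :
    Matrix m (Fin h × i) ℝ :=
  Matrix.of fun a jb => if hj : (jb.1 : ℕ) < σ then M a (⟨jb.1, hj⟩, jb.2) else 0

/-- `N = (I, 0)` with `σ` block rows and `h` block columns. -/
def selectFirst (σ h : ℕ) (z : Type*) [DecidableEq z] : Matrix (Fin σ × z) (Fin h × z) ℝ :=
  padCols h (1 : Matrix (Fin σ × z) (Fin σ × z) ℝ)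

/-- `P̂`, built blockwise as `I_σ ⊗ Q`, `I_σ ⊗ S`, `I_σ ⊗ Sᵀ`, `I_σ ⊗ R` from
`P = [Q, S; Sᵀ, R]`. -/
def liftMultiplier {z w : Type*} (σ : ℕ) (P : Matrix (z ⊕ w) (z ⊕ w) ℝ) :
    Matrix ((Fin σ × z) ⊕ (Fin σ × w)) ((Fin σ × z) ⊕ (Fin σ × w)) ℝ :=
  Matrix.fromBlocks
    ((1 : Matrix (Fin σ) (Fin σ) ℝ) ⊗ₖ P.toBlocks₁₁)
    ((1 : Matrix (Fin σ) (Fin σ) ℝ) ⊗ₖ P.toBlocks₁₂)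
    ((1 : Matrix (Fin σ) (Fin σ) ℝ) ⊗ₖ P.toBlocks₂₁)
    ((1 : Matrix (Fin σ) (Fin σ) ℝ) ⊗ₖ P.toBlocks₂₂)

/-- The performance index `P_γ = diag(I, -γ² I)`. -/
def performanceIndex (e d : Type*) [DecidableEq e] [DecidableEq d] (γ : ℝ) :
    Matrix (e ⊕ d) (e ⊕ d) ℝ :=
  Matrix.fromBlocks 1 0 0 (-(γ ^ 2 • (1 : Matrix d d ℝ)))

/-! ### Square summable sequences -/

/-- `s ∈ ℓ₂`. -/
def IsSquareSummable {ι : Type*} [Fintype ι] (s : ℕ → ι → ℝ) : Prop :=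
  Summable fun k => s k ⬝ᵥ s k

/-- The `ℓ₂` norm, with value `∞` for sequences that are not square summable. -/
noncomputable def l2Norm {ι : Type*} [Fintype ι] (s : ℕ → ι → ℝ) : ℝ≥0∞ :=
  (∑' k, ENNReal.ofReal (s k ⬝ᵥ s k)) ^ (1 / 2 : ℝ)

/-! ### Linear fractional representations -/

/-- The known real matrices of an LFR with state `x`, uncertainty channel `w`, `z`, noise `n`,
input `r`, error `e` and measured output `y`. -/
structure LFR (nx nw nn nr nz ne ny : ℕ) where
  A : Matrix (Fin nx) (Fin nx) ℝ
  Bw : Matrix (Fin nx) (Fin nw) ℝ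
  Bn : Matrix (Fin nx) (Fin nn) ℝ
  Br : Matrix (Fin nx) (Fin nr) ℝ
  Cz : Matrix (Fin nz) (Fin nx) ℝ
  Dzw : Matrix (Fin nz) (Fin nw) ℝ
  Dzn : Matrix (Fin nz) (Fin nn) ℝ
  Dzr : Matrix (Fin nz) (Fin nr) ℝ
  Ce : Matrix (Fin ne) (Fin nx) ℝ
  Dew : Matrix (Fin ne) (Fin nw) ℝ
  Den : Matrix (Fin ne) (Fin nn) ℝ
  Der : Matrix (Fin ne) (Fin nr) ℝ
  Cy : Matrix (Fin ny) (Fin nx) ℝ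
  Dyw : Matrix (Fin ny) (Fin nw) ℝ
  Dyn : Matrix (Fin ny) (Fin nn) ℝ
  Dyr : Matrix (Fin ny) (Fin nr) ℝ

namespace LFR

variable {nx nw nn nr nz ne ny : ℕ} (G : LFR nx nw nn nr nz ne ny)

/-- `B_d = (B_n, B_r)`. -/
def Bd : Matrix (Fin nx) (Fin nn ⊕ Fin nr) ℝ := Matrix.fromCols G.Bn G.Br

/-- `D_zd = (D_zn, D_zr)`. -/
def Dzd : Matrix (Fin nz) (Fin nn ⊕ Fin nr) ℝ := Matrix.fromCols G.Dzn G.Dzr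

/-- `D_ed = (D_en, D_er)`. -/
def Ded : Matrix (Fin ne) (Fin nn ⊕ Fin nr) ℝ := Matrix.fromCols G.Den G.Der

/-- The equations of the interconnection with uncertainty `Δ` at one time instant, where `x'` is
the next state. -/
def SolvesAt (Δ : Matrix (Fin nw) (Fin nz) ℝ) (x' x : Fin nx → ℝ) (w : Fin nw → ℝ)
    (z : Fin nz → ℝ) (n : Fin nn → ℝ) (r : Fin nr → ℝ) (e : Fin ne → ℝ) (y : Fin ny → ℝ) :
    Prop :=
  x' = G.A *ᵥ x + G.Bw *ᵥ w + G.Bn *ᵥ n + G.Br *ᵥ r ∧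
  z = G.Cz *ᵥ x + G.Dzw *ᵥ w + G.Dzn *ᵥ n + G.Dzr *ᵥ r ∧
  e = G.Ce *ᵥ x + G.Dew *ᵥ w + G.Den *ᵥ n + G.Der *ᵥ r ∧
  y = G.Cy *ᵥ x + G.Dyw *ᵥ w + G.Dyn *ᵥ n + G.Dyr *ᵥ r ∧
  w = Δ *ᵥ z

/-- The signals form a trajectory of the interconnection on the whole time axis. -/
def IsTrajectory (Δ : Matrix (Fin nw) (Fin nz) ℝ) (x : ℕ → Fin nx → ℝ) (w : ℕ → Fin nw → ℝ)
    (z : ℕ → Fin nz → ℝ) (n : ℕ → Fin nn → ℝ) (r : ℕ → Fin nr → ℝ) (e : ℕ → Fin ne → ℝ)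
    (y : ℕ → Fin ny → ℝ) : Prop :=
  ∀ k, G.SolvesAt Δ (x (k + 1)) (x k) (w k) (z k) (n k) (r k) (e k) (y k)

/-- Well-posedness and exponential stability of the interconnection for vanishing inputs. -/
def IsStable (Δ : Matrix (Fin nw) (Fin nz) ℝ) : Prop :=
  IsUnit (1 - G.Dzw * Δ) ∧
  ∃ M > (0 : ℝ), ∃ α > (0 : ℝ), ∀ x w z e y,
    G.IsTrajectory Δ x w z 0 0 e y →
      ∀ t : ℕ, ‖WithLp.toLp 2 (x t)‖ ≤ M * Real.exp (-α * t) * ‖WithLp.toLp 2 (x 0)‖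

/-- The generalized disturbance `d = (n, r)`. -/
def genDisturbance (n : ℕ → Fin nn → ℝ) (r : ℕ → Fin nr → ℝ) : ℕ → Fin nn ⊕ Fin nr → ℝ :=
  fun k => Sum.elim (n k) (r k)

/-- The energy gain `sup ‖e‖ / ‖d‖` over `d ∈ ℓ₂ \ {0}` and `x(0) = 0`, as an extended
nonnegative number. -/
noncomputable def energyGain (Δ : Matrix (Fin nw) (Fin nz) ℝ) : ℝ≥0∞ :=
  sSup {g | ∃ x w z n r e y, G.IsTrajectory Δ x w z n r e y ∧ x 0 = 0 ∧
    IsSquareSummable (genDisturbance n r) ∧ genDisturbance n r ≠ 0 ∧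
    g = l2Norm e / l2Norm (genDisturbance n r)}

/-- The set of all uncertainties compatible with the data: the interconnection with
`x(0) = xs` can respond to the (stacked) input `(ns, rs)` with the measured output `ys` on the
time instants `0, …, h - 1`. -/
def compatibleUncertainties (h : ℕ) (xs : Fin nx → ℝ) (ns : Fin h × Fin nn → ℝ)
    (rs : Fin h × Fin nr → ℝ) (ys : Fin h × Fin ny → ℝ) : Set (Matrix (Fin nw) (Fin nz) ℝ) :=
  {Δ | ∃ (x : ℕ → Fin nx → ℝ) (w : ℕ → Fin nw → ℝ) (z : ℕ → Fin nz → ℝ) (e : ℕ → Fin ne → ℝ),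
    x 0 = xs ∧ ∀ k : Fin h, G.SolvesAt Δ (x (k + 1)) (x k) (w k) (z k)
      (fun i => ns (k, i)) (fun i => rs (k, i)) (e k) (fun i => ys (k, i))}

/-! The lifted matrices of the LFR. -/

def hBw (h : ℕ) : Matrix (Fin nx) (Fin h × Fin nw) ℝ := liftB h G.A G.Bw

def hBd (h : ℕ) : Matrix (Fin nx) (Fin h × (Fin nn ⊕ Fin nr)) ℝ := liftB h G.A G.Bd

def hCz (h : ℕ) : Matrix (Fin h × Fin nz) (Fin nx) ℝ := liftC h G.A G.Cz

def hCe (h : ℕ) : Matrix (Fin h × Fin ne) (Fin nx) ℝ := liftC h G.A G.Ce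

def hCy (h : ℕ) : Matrix (Fin h × Fin ny) (Fin nx) ℝ := liftC h G.A G.Cy

def hDzw (h : ℕ) : Matrix (Fin h × Fin nz) (Fin h × Fin nw) ℝ :=
  liftD h G.A G.Bw G.Cz G.Dzw

def hDzn (h : ℕ) : Matrix (Fin h × Fin nz) (Fin h × Fin nn) ℝ :=
  liftD h G.A G.Bn G.Cz G.Dzn

def hDzr (h : ℕ) : Matrix (Fin h × Fin nz) (Fin h × Fin nr) ℝ :=
  liftD h G.A G.Br G.Cz G.Dzr

def hDzd (h : ℕ) : Matrix (Fin h × Fin nz) (Fin h × (Fin nn ⊕ Fin nr)) ℝ :=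
  liftD h G.A G.Bd G.Cz G.Dzd

def hDew (h : ℕ) : Matrix (Fin h × Fin ne) (Fin h × Fin nw) ℝ :=
  liftD h G.A G.Bw G.Ce G.Dew

def hDed (h : ℕ) : Matrix (Fin h × Fin ne) (Fin h × (Fin nn ⊕ Fin nr)) ℝ :=
  liftD h G.A G.Bd G.Ce G.Ded

def hDyw (h : ℕ) : Matrix (Fin h × Fin ny) (Fin h × Fin nw) ℝ :=
  liftD h G.A G.Bw G.Cy G.Dyw

def hDyn (h : ℕ) : Matrix (Fin h × Fin ny) (Fin h × Fin nn) ℝ :=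
  liftD h G.A G.Bn G.Cy G.Dyn

def hDyr (h : ℕ) : Matrix (Fin h × Fin ny) (Fin h × Fin nr) ℝ :=
  liftD h G.A G.Br G.Cy G.Dyr

/-- `ker D̂_hyw ⊆ ker (B̂_σw, 0)` and `ker D̂_hyw ⊆ ker (D̂_σew, 0)`. -/
def KernelInclusion (h σ : ℕ) : Prop :=
  LinearMap.ker (G.hDyw h).mulVecLin ≤ LinearMap.ker (padCols h (G.hBw σ)).mulVecLin ∧
  LinearMap.ker (G.hDyw h).mulVecLin ≤ LinearMap.ker (padCols h (G.hDew σ)).mulVecLin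

/-- `M_b = (B̂_σw, 0) D̂_hyw⁺`. -/
noncomputable def Mb (h σ : ℕ) : Matrix (Fin nx) (Fin h × Fin ny) ℝ :=
  padCols h (G.hBw σ) * moorePenroseInverse (G.hDyw h)

/-- `M_d = (D̂_σew, 0) D̂_hyw⁺`. -/
noncomputable def Md (h σ : ℕ) : Matrix (Fin σ × Fin ne) (Fin h × Fin ny) ℝ :=
  padCols h (G.hDew σ) * moorePenroseInverse (G.hDyw h)

/-- The matrix with block rows `(y, 0)`, `(x, 0)`, `(0, I)`, `(r, 0)`. -/
def dataMatrix (h : ℕ) (xs : Fin nx → ℝ) (rs : Fin h × Fin nr → ℝ)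
    (ys : Fin h × Fin ny → ℝ) :
    Matrix ((Fin h × Fin ny) ⊕ Fin nx ⊕ (Fin h × Fin nn) ⊕ (Fin h × Fin nr))
      (Unit ⊕ (Fin h × Fin nn)) ℝ :=
  Matrix.fromRows (Matrix.fromCols (Matrix.replicateCol Unit ys) 0) <|
  Matrix.fromRows (Matrix.fromCols (Matrix.replicateCol Unit xs) 0) <|
  Matrix.fromRows (Matrix.fromCols 0 1)
    (Matrix.fromCols (Matrix.replicateCol Unit rs) 0)

/-- The matrix with block rows `(0, I)`, `(-Ĉ_hzᵀ, -Ĉ_hyᵀ)`, `(-D̂_hznᵀ, -D̂_hynᵀ)`,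
`(-D̂_hzrᵀ, -D̂_hyrᵀ)`. -/
def dataOuterFactor (h : ℕ) :
    Matrix ((Fin h × Fin ny) ⊕ Fin nx ⊕ (Fin h × Fin nn) ⊕ (Fin h × Fin nr))
      ((Fin h × Fin nz) ⊕ (Fin h × Fin ny)) ℝ :=
  Matrix.fromRows (Matrix.fromCols 0 1) <|
  Matrix.fromRows (Matrix.fromCols (-(G.hCz h)ᵀ) (-(G.hCy h)ᵀ)) <|
  Matrix.fromRows (Matrix.fromCols (-(G.hDzn h)ᵀ) (-(G.hDyn h)ᵀ))
    (Matrix.fromCols (-(G.hDzr h)ᵀ) (-(G.hDyr h)ᵀ))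

/-- The data-dependent multiplier set `P_D` generated by the multiplier set `Pns` for the
noise. -/
def dataMultiplierSet (h : ℕ) (xs : Fin nx → ℝ) (rs : Fin h × Fin nr → ℝ)
    (ys : Fin h × Fin ny → ℝ)
    (Pns : Set (Matrix (Unit ⊕ (Fin h × Fin nn)) (Unit ⊕ (Fin h × Fin nn)) ℝ)) :
    Set (Matrix ((Fin h × Fin nz) ⊕ (Fin h × Fin ny))
      ((Fin h × Fin nz) ⊕ (Fin h × Fin ny)) ℝ) :=
  {PD | ∃ Pn ∈ Pns,
    PD = symProduct Pn ((dataMatrix h xs rs ys).transpose * G.dataOuterFactor h)}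

/-- The outer factor of the lifted LMI; its block columns have sizes `n`, `σ n_z`, `σ n_e`. -/
noncomputable def lmiOuterFactor (h σ : ℕ) :
    Matrix ((Fin nx ⊕ Fin nx) ⊕ ((Fin σ × Fin nz) ⊕ (Fin σ × Fin nw)) ⊕
        ((Fin h × Fin nz) ⊕ (Fin h × Fin ny)) ⊕
        ((Fin σ × Fin ne) ⊕ (Fin σ × (Fin nn ⊕ Fin nr))))
      (Fin nx ⊕ (Fin σ × Fin nz) ⊕ (Fin σ × Fin ne)) ℝ :=
  Matrix.fromRows
    (Matrix.fromRows
      (Matrix.fromCols 1 (Matrix.fromCols 0 0))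
      (Matrix.fromCols (-(G.A ^ σ)ᵀ) (Matrix.fromCols (-(G.hCz σ)ᵀ) (-(G.hCe σ)ᵀ)))) <|
  Matrix.fromRows
    (Matrix.fromRows
      (Matrix.fromCols 0 (Matrix.fromCols 1 0))
      (Matrix.fromCols (-(G.hBw σ)ᵀ) (Matrix.fromCols (-(G.hDzw σ)ᵀ) (-(G.hDew σ)ᵀ)))) <|
  Matrix.fromRows
    (Matrix.fromRows
      (Matrix.fromCols 0 (Matrix.fromCols (selectFirst σ h (Fin nz))ᵀ 0))
      (Matrix.fromCols (G.Mb h σ)ᵀ (Matrix.fromCols 0 (G.Md h σ)ᵀ)))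
    (Matrix.fromRows
      (Matrix.fromCols 0 (Matrix.fromCols 0 1))
      (Matrix.fromCols (-(G.hBd σ)ᵀ) (Matrix.fromCols (-(G.hDzd σ)ᵀ) (-(G.hDed σ)ᵀ))))

/-- The middle factor `diag(X, -X, P̂, P_D, P_γ⁻¹)` of the lifted LMI. -/
noncomputable def lmiMiddleFactor {h : ℕ} (σ : ℕ) (γ : ℝ) (X : Matrix (Fin nx) (Fin nx) ℝ)
    (P : Matrix (Fin nz ⊕ Fin nw) (Fin nz ⊕ Fin nw) ℝ)
    (PD : Matrix ((Fin h × Fin nz) ⊕ (Fin h × Fin ny))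
      ((Fin h × Fin nz) ⊕ (Fin h × Fin ny)) ℝ) :
    Matrix ((Fin nx ⊕ Fin nx) ⊕ ((Fin σ × Fin nz) ⊕ (Fin σ × Fin nw)) ⊕
        ((Fin h × Fin nz) ⊕ (Fin h × Fin ny)) ⊕
        ((Fin σ × Fin ne) ⊕ (Fin σ × (Fin nn ⊕ Fin nr))))
      ((Fin nx ⊕ Fin nx) ⊕ ((Fin σ × Fin nz) ⊕ (Fin σ × Fin nw)) ⊕
        ((Fin h × Fin nz) ⊕ (Fin h × Fin ny)) ⊕
        ((Fin σ × Fin ne) ⊕ (Fin σ × (Fin nn ⊕ Fin nr)))) ℝ :=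
  Matrix.fromBlocks (Matrix.fromBlocks X 0 0 (-X)) 0 0 <|
  Matrix.fromBlocks (liftMultiplier σ P) 0 0 <|
  Matrix.fromBlocks PD 0 0
    (performanceIndex (Fin σ × Fin ne) (Fin σ × (Fin nn ⊕ Fin nr)) γ)⁻¹

/-- The lifted LMI. -/
def LiftedLMI (h σ : ℕ) (γ : ℝ) (X : Matrix (Fin nx) (Fin nx) ℝ)
    (P : Matrix (Fin nz ⊕ Fin nw) (Fin nz ⊕ Fin nw) ℝ)
    (PD : Matrix ((Fin h × Fin nz) ⊕ (Fin h × Fin ny))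
      ((Fin h × Fin nz) ⊕ (Fin h × Fin ny)) ℝ) : Prop :=
  (symProduct (lmiMiddleFactor σ γ X P PD) (G.lmiOuterFactor h σ)).PosDef

end LFR

open Matrix

/-! ### Quadratic forms of real matrices -/

theorem symProduct_form {m n : Type*} [Fintype m] [Fintype n] (P : Matrix m m ℝ)
    (M : Matrix m n ℝ) (v : n → ℝ) :
    v ⬝ᵥ symProduct P M *ᵥ v = (M *ᵥ v) ⬝ᵥ P *ᵥ (M *ᵥ v) := by
  rw [symProduct, ← mulVec_mulVec, ← mulVec_mulVec, dotProduct_mulVec v Mᵀ, vecMul_transpose]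

/-- The form attains a positive minimum on the compact unit sphere, and homogeneity extends the
bound to all vectors. -/
theorem Matrix.PosDef.exists_mul_dotProduct_le {n : Type*} [Fintype n] {M : Matrix n n ℝ}
    (hM : M.PosDef) : ∃ c > 0, ∀ v, c * (v ⬝ᵥ v) ≤ v ⬝ᵥ M *ᵥ v := by
  classical
  have hcont : Continuous fun v : EuclideanSpace ℝ n => v.ofLp ⬝ᵥ M *ᵥ v.ofLp := by fun_prop
  have hnorm : ∀ v : EuclideanSpace ℝ n, v.ofLp ⬝ᵥ v.ofLp = ‖v‖ ^ 2 := by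
    intro v
    rw [EuclideanSpace.real_norm_sq_eq]
    simp [dotProduct, pow_two]
  rcases (Metric.sphere (0 : EuclideanSpace ℝ n) 1).eq_empty_or_nonempty with h | h
  -- An empty sphere means that the index type is empty, so the only vector is zero and any constant
  -- works.
  · refine ⟨1, one_pos, fun v => ?_⟩
    have hv : v = 0 := by
      by_contra hv
      have hv' : WithLp.toLp 2 v ≠ 0 := by simpa using hv
      have : (‖WithLp.toLp 2 v‖⁻¹ • WithLp.toLp 2 v) ∈ Metric.sphere (0 : EuclideanSpace ℝ n) 1 := by
        rw [mem_sphere_zero_iff_norm, norm_smul, norm_inv, norm_norm,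
          inv_mul_cancel₀ (norm_ne_zero_iff.2 hv')]
      rw [h] at this
      exact this
    simp [hv]
  · obtain ⟨u, hu, hmin⟩ := (isCompact_sphere (0 : EuclideanSpace ℝ n) 1).exists_isMinOn h
      hcont.continuousOn
    have hu0 : u.ofLp ≠ 0 := by
      intro h0
      have : u = 0 := by ext i; simpa using congrFun h0 i
      simp [this] at hu
    refine ⟨u.ofLp ⬝ᵥ M *ᵥ u.ofLp, by simpa using hM.dotProduct_mulVec_pos hu0, fun v => ?_⟩
    by_cases hv : v = 0
    · simp [hv]
    have hv' : WithLp.toLp 2 v ≠ 0 := by simpa using hv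
    have hpos : 0 < ‖WithLp.toLp 2 v‖ := norm_pos_iff.2 hv'
    have hmem : (‖WithLp.toLp 2 v‖⁻¹ • WithLp.toLp 2 v) ∈
        Metric.sphere (0 : EuclideanSpace ℝ n) 1 := by
      rw [mem_sphere_zero_iff_norm, norm_smul, norm_inv, norm_norm, inv_mul_cancel₀ hpos.ne']
    have h1 := isMinOn_iff.1 hmin _ hmem
    have h2 := hnorm (WithLp.toLp 2 v)
    simp only [WithLp.ofLp_smul, mulVec_smul, smul_dotProduct, dotProduct_smul, smul_eq_mul] at h1 h2
    rw [h2]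
    have h3 := mul_le_mul_of_nonneg_right h1 (sq_nonneg ‖WithLp.toLp 2 v‖)
    refine h3.trans_eq ?_
    field_simp

theorem Matrix.exists_form_le {n : Type*} [Fintype n] (M : Matrix n n ℝ) :
    ∃ C > 0, ∀ v, v ⬝ᵥ M *ᵥ v ≤ C * (v ⬝ᵥ v) := by
  -- The summand 1 only makes the constant positive when `M` vanishes.
  refine ⟨∑ i, ∑ j, |M i j| + 1, by positivity, fun v => ?_⟩
  have hsq : ∀ i, v i * v i ≤ v ⬝ᵥ v := fun i =>
    Finset.single_le_sum (f := fun i => v i * v i) (fun i _ => mul_self_nonneg _)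
      (Finset.mem_univ i)
  have h0 : 0 ≤ v ⬝ᵥ v := Finset.sum_nonneg fun i _ => mul_self_nonneg _
  have h1 : v ⬝ᵥ M *ᵥ v ≤ (∑ i, ∑ j, |M i j|) * (v ⬝ᵥ v) := by
    rw [Finset.sum_mul]
    refine Finset.sum_le_sum fun i _ => ?_
    rw [Finset.sum_mul, mulVec, dotProduct, Finset.mul_sum]
    refine Finset.sum_le_sum fun j _ => ?_
    have h2 : |v i * v j| ≤ v ⬝ᵥ v := by
      rw [abs_mul]
      nlinarith [hsq i, hsq j, sq_nonneg (|v i| - |v j|), abs_mul_abs_self (v i),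
        abs_mul_abs_self (v j)]
    calc v i * (M i j * v j) ≤ |v i * (M i j * v j)| := le_abs_self _
      _ = |M i j| * |v i * v j| := by simp only [abs_mul]; ring
      _ ≤ |M i j| * (v ⬝ᵥ v) := by gcongr
  linarith

theorem Matrix.dotProduct_self_nonneg_real {n : Type*} [Fintype n] (v : n → ℝ) : 0 ≤ v ⬝ᵥ v :=
  Finset.sum_nonneg fun _ _ => mul_self_nonneg _

/-- The dual inequality `αᵀ X α + β·β / γ² ≤ a` and the pairing `α·x + β·d = a` bound `a` by
the primal supply. -/
theorem dual_le_primal {n d : Type*} [Fintype n] [DecidableEq n] [Fintype d]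
    {X : Matrix n n ℝ} (hX : X.PosDef) {γ a ρ : ℝ} (hγ : 0 < γ) (hρ : 0 < ρ)
    {α x : n → ℝ} {β v : d → ℝ}
    (hdual : α ⬝ᵥ X *ᵥ α + (γ ^ 2)⁻¹ * (β ⬝ᵥ β) ≤ ρ * a) (hpair : α ⬝ᵥ x + β ⬝ᵥ v = a) :
    a ≤ ρ * (x ⬝ᵥ X⁻¹ *ᵥ x + γ ^ 2 * (v ⬝ᵥ v)) := by
  have hdet : IsUnit X.det := (isUnit_iff_isUnit_det X).1 hX.isUnit
  have hXX : X *ᵥ (X⁻¹ *ᵥ x) = x := by rw [mulVec_mulVec, mul_nonsing_inv _ hdet, one_mulVec]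
  have hXt : Xᵀ = X := hX.isHermitian
  -- The squares of `α - ρ X⁻¹ x` in the metric `X` and of `γ⁻¹ β - ρ γ v` have cross terms adding
  -- up to `-2 ρ a`; with `hdual` this leaves `0 ≤ ρ (ρ (…) - a)`.
  have h1 : 0 ≤ (α - ρ • X⁻¹ *ᵥ x) ⬝ᵥ X *ᵥ (α - ρ • X⁻¹ *ᵥ x) := by
    simpa using hX.posSemidef.dotProduct_mulVec_nonneg (α - ρ • X⁻¹ *ᵥ x)
  have h2 := dotProduct_self_nonneg_real (γ⁻¹ • β - (ρ * γ) • v)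
  have h3 : (X⁻¹ *ᵥ x) ⬝ᵥ X *ᵥ α = α ⬝ᵥ x := by
    rw [← dotProduct_transpose_mulVec, hXt, hXX]
  have h4 : (X⁻¹ *ᵥ x) ⬝ᵥ x = x ⬝ᵥ X⁻¹ *ᵥ x := dotProduct_comm _ _
  have h5 : v ⬝ᵥ β = β ⬝ᵥ v := dotProduct_comm _ _
  simp only [mulVec_sub, mulVec_smul, sub_dotProduct, dotProduct_sub, smul_dotProduct,
    dotProduct_smul, smul_eq_mul, hXX, h3, h4, h5] at h1 h2
  have h6 : γ⁻¹ * (γ⁻¹ * (β ⬝ᵥ β) - ρ * γ * (β ⬝ᵥ v)) -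
      ρ * γ * (γ⁻¹ * (β ⬝ᵥ v) - ρ * γ * (v ⬝ᵥ v)) =
      (γ ^ 2)⁻¹ * (β ⬝ᵥ β) - 2 * ρ * (β ⬝ᵥ v) + ρ ^ 2 * γ ^ 2 * (v ⬝ᵥ v) := by
    field_simp
    ring
  rw [h6] at h2
  have h9 : 0 ≤ ρ * (ρ * (x ⬝ᵥ X⁻¹ *ᵥ x + γ ^ 2 * (v ⬝ᵥ v)) - a) := by
    rw [← hpair] at hdual ⊢
    linarith
  have := nonneg_of_mul_nonneg_right h9 hρ
  linarith

/-! ### Lifted multipliers -/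

theorem one_kronecker_mulVec {k m n : Type*} [Fintype k] [DecidableEq k] [Fintype n]
    (M : Matrix m n ℝ) (v : k × n → ℝ) :
    ((1 : Matrix k k ℝ) ⊗ₖ M) *ᵥ v = fun p => (M *ᵥ fun i => v (p.1, i)) p.2 := by
  funext p
  simp only [mulVec, dotProduct, kroneckerMap_apply, Fintype.sum_prod_type, one_apply]
  rw [Finset.sum_eq_single p.1]
  · simp
  · intro b _ hb
    simp [hb.symm]
  · simp

theorem form_nonpos_of_dual_multiplier {z w : Type*} [Fintype z] [Fintype w] [DecidableEq w]
    {Δ : Matrix w z ℝ} {P : Matrix (z ⊕ w) (z ⊕ w) ℝ}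
    (hP : (-symProduct P (fromRows (-Δᵀ) (1 : Matrix w w ℝ))).PosSemidef) (v : w → ℝ) :
    Sum.elim (-(Δᵀ *ᵥ v)) v ⬝ᵥ P *ᵥ Sum.elim (-(Δᵀ *ᵥ v)) v ≤ 0 := by
  have h := hP.dotProduct_mulVec_nonneg v
  simp only [star_trivial, neg_mulVec, dotProduct_neg, symProduct_form, fromRows_mulVec,
    one_mulVec] at h
  linarith

theorem liftMultiplier_form {z w : Type*} [Fintype z] [Fintype w] (σ : ℕ)
    (P : Matrix (z ⊕ w) (z ⊕ w) ℝ) (u : Fin σ × z → ℝ) (v : Fin σ × w → ℝ) :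
    Sum.elim u v ⬝ᵥ liftMultiplier σ P *ᵥ Sum.elim u v =
      ∑ k, Sum.elim (fun i => u (k, i)) (fun i => v (k, i)) ⬝ᵥ
        P *ᵥ Sum.elim (fun i => u (k, i)) (fun i => v (k, i)) := by
  conv_rhs => rw [← fromBlocks_toBlocks P]
  simp only [liftMultiplier, fromBlocks_mulVec, Sum.elim_comp_inl, Sum.elim_comp_inr,
    sumElim_dotProduct_sumElim, one_kronecker_mulVec, Finset.sum_add_distrib, dotProduct_add]
  simp only [dotProduct, Fintype.sum_prod_type]

/-- Blockwise, `(Δᵀ v, -v)` is the vector `(-Δᵀ u, u)` with `u = -v`, so the multiplier inequality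
applies to every summand. The signs match the rows of the outer factor that carry `q` and minus the
adjoint output. -/
theorem liftMultiplier_form_nonpos {z w : Type*} [Fintype z] [Fintype w] [DecidableEq w] {σ : ℕ}
    {Δ : Matrix w z ℝ} {P : Matrix (z ⊕ w) (z ⊕ w) ℝ}
    (hP : (-symProduct P (fromRows (-Δᵀ) (1 : Matrix w w ℝ))).PosSemidef)
    (v : Fin σ × w → ℝ) :
    Sum.elim (((1 : Matrix (Fin σ) (Fin σ) ℝ) ⊗ₖ Δᵀ) *ᵥ v) (-v) ⬝ᵥ
      liftMultiplier σ P *ᵥ Sum.elim (((1 : Matrix (Fin σ) (Fin σ) ℝ) ⊗ₖ Δᵀ) *ᵥ v) (-v) ≤ 0 := by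
  rw [liftMultiplier_form]
  refine Finset.sum_nonpos fun k _ => ?_
  have h := form_nonpos_of_dual_multiplier hP (-fun i => v (k, i))
  simp only [mulVec_neg, neg_neg] at h
  simp only [one_kronecker_mulVec]
  exact h

theorem performanceIndex_inv (e d : Type*) [Fintype e] [Fintype d] [DecidableEq e]
    [DecidableEq d] {γ : ℝ} (hγ : γ ≠ 0) :
    (performanceIndex e d γ)⁻¹ = fromBlocks 1 0 0 (-((γ ^ 2)⁻¹ • (1 : Matrix d d ℝ))) := by
  refine inv_eq_right_inv ?_
  rw [performanceIndex, fromBlocks_multiply]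
  simp [smul_smul, hγ]

/-! ### The lifted LMI as an inequality of quadratic forms -/

namespace LFR

variable {nx nw nn nr nz ne ny : ℕ} (G : LFR nx nw nn nr nz ne ny)

/-- The adjoint state `Âᵀ p + Ĉ_zᵀ q + Ĉ_eᵀ s` at the beginning of a block. -/
def adjointState (σ : ℕ) (p : Fin nx → ℝ) (q : Fin σ × Fin nz → ℝ) (s : Fin σ × Fin ne → ℝ) :
    Fin nx → ℝ :=
  (G.A ^ σ)ᵀ *ᵥ p + ((G.hCz σ)ᵀ *ᵥ q + (G.hCe σ)ᵀ *ᵥ s)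

/-- The adjoint output `B̂_wᵀ p + D̂_zwᵀ q + D̂_ewᵀ s` of the uncertainty channel. -/
def adjointUncertainty (σ : ℕ) (p : Fin nx → ℝ) (q : Fin σ × Fin nz → ℝ)
    (s : Fin σ × Fin ne → ℝ) : Fin σ × Fin nw → ℝ :=
  (G.hBw σ)ᵀ *ᵥ p + ((G.hDzw σ)ᵀ *ᵥ q + (G.hDew σ)ᵀ *ᵥ s)

/-- The adjoint output `B̂_dᵀ p + D̂_zdᵀ q + D̂_edᵀ s` of the disturbance channel. -/
def adjointDisturbance (σ : ℕ) (p : Fin nx → ℝ) (q : Fin σ × Fin nz → ℝ)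
    (s : Fin σ × Fin ne → ℝ) : Fin σ × (Fin nn ⊕ Fin nr) → ℝ :=
  (G.hBd σ)ᵀ *ᵥ p + ((G.hDzd σ)ᵀ *ᵥ q + (G.hDed σ)ᵀ *ᵥ s)

variable {G}

/-- Positive definiteness is used in the quantified form with a margin `c`, which later yields both
solvability of the adjoint loop and the contraction rate. -/
theorem LiftedLMI.exists_form_le {h σ : ℕ} {γ : ℝ} (hγ : γ ≠ 0)
    {X : Matrix (Fin nx) (Fin nx) ℝ} {P : Matrix (Fin nz ⊕ Fin nw) (Fin nz ⊕ Fin nw) ℝ}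
    {PD : Matrix ((Fin h × Fin nz) ⊕ (Fin h × Fin ny)) ((Fin h × Fin nz) ⊕ (Fin h × Fin ny)) ℝ}
    (hLMI : G.LiftedLMI h σ γ X P PD) :
    ∃ c > 0, ∀ p q s, c * (p ⬝ᵥ p + (q ⬝ᵥ q + s ⬝ᵥ s)) ≤
      p ⬝ᵥ X *ᵥ p - G.adjointState σ p q s ⬝ᵥ X *ᵥ G.adjointState σ p q s +
      (Sum.elim q (-G.adjointUncertainty σ p q s) ⬝ᵥ
        liftMultiplier σ P *ᵥ Sum.elim q (-G.adjointUncertainty σ p q s) +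
      (Sum.elim ((selectFirst σ h (Fin nz))ᵀ *ᵥ q) ((G.Mb h σ)ᵀ *ᵥ p + (G.Md h σ)ᵀ *ᵥ s) ⬝ᵥ
        PD *ᵥ Sum.elim ((selectFirst σ h (Fin nz))ᵀ *ᵥ q)
          ((G.Mb h σ)ᵀ *ᵥ p + (G.Md h σ)ᵀ *ᵥ s) +
      (s ⬝ᵥ s - (γ ^ 2)⁻¹ * (G.adjointDisturbance σ p q s ⬝ᵥ G.adjointDisturbance σ p q s)))) := by
  obtain ⟨c, hc, hle⟩ := Matrix.PosDef.exists_mul_dotProduct_le hLMI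
  refine ⟨c, hc, fun p q s => ?_⟩
  have h := hle (Sum.elim p (Sum.elim q s))
  have hx : -((G.A ^ σ)ᵀ *ᵥ p) + (-((G.hCz σ)ᵀ *ᵥ q) + -((G.hCe σ)ᵀ *ᵥ s)) =
      -G.adjointState σ p q s := by rw [adjointState]; abel
  have hw : -((G.hBw σ)ᵀ *ᵥ p) + (-((G.hDzw σ)ᵀ *ᵥ q) + -((G.hDew σ)ᵀ *ᵥ s)) =
      -G.adjointUncertainty σ p q s := by rw [adjointUncertainty]; abel
  have hd : -((G.hBd σ)ᵀ *ᵥ p) + (-((G.hDzd σ)ᵀ *ᵥ q) + -((G.hDed σ)ᵀ *ᵥ s)) =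
      -G.adjointDisturbance σ p q s := by rw [adjointDisturbance]; abel
  rw [symProduct_form] at h
  simp only [lmiMiddleFactor, lmiOuterFactor, performanceIndex_inv _ _ hγ, fromRows_mulVec,
    fromCols_mulVec_sumElim, one_mulVec, zero_mulVec, neg_mulVec, add_zero, zero_add, neg_zero,
    hx, hw, hd, fromBlocks_mulVec, Sum.elim_comp_inl, Sum.elim_comp_inr,
    sumElim_dotProduct_sumElim, smul_mulVec, neg_dotProduct, mulVec_neg,
    dotProduct_smul, smul_eq_mul, neg_neg] at h
  refine h.trans_eq ?_
  ring

end LFR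

/-! ### Lifted matrices acting on stacked signals -/

/-- The first `h` values of a signal, stacked. -/
def stack {ι : Type*} (h : ℕ) (u : ℕ → ι → ℝ) : Fin h × ι → ℝ := fun p => u p.1 p.2

theorem stack_dotProduct_stack {ι : Type*} [Fintype ι] (h : ℕ) (u v : ℕ → ι → ℝ) :
    stack h u ⬝ᵥ stack h v = ∑ k ∈ Finset.range h, u k ⬝ᵥ v k := by
  rw [Finset.sum_range, dotProduct, Fintype.sum_prod_type]
  rfl

theorem one_kronecker_mulVec_stack {i o : Type*} [Fintype i] {h : ℕ}
    (M : Matrix o i ℝ) (u : ℕ → i → ℝ) :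
    ((1 : Matrix (Fin h) (Fin h) ℝ) ⊗ₖ M) *ᵥ stack h u = stack h fun k => M *ᵥ u k := by
  rw [one_kronecker_mulVec]
  rfl

section Lifting

variable {n i o : Type*} [Fintype n] [DecidableEq n]

theorem liftB_mulVec_stack [Fintype i] (h : ℕ) (A : Matrix n n ℝ) (B : Matrix n i ℝ)
    (u : ℕ → i → ℝ) :
    liftB h A B *ᵥ stack h u = ∑ k ∈ Finset.range h, A ^ (h - 1 - k) *ᵥ (B *ᵥ u k) := by
  funext a
  rw [Finset.sum_apply, Finset.sum_range]
  simp only [mulVec_mulVec]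
  simp only [mulVec, dotProduct, liftB, stack, of_apply, Fintype.sum_prod_type]

theorem liftC_mulVec (h : ℕ) (A : Matrix n n ℝ) (C : Matrix o n ℝ) (x : n → ℝ) :
    liftC h A C *ᵥ x = stack h fun k => C *ᵥ (A ^ k *ᵥ x) := by
  funext p
  simp only [stack, mulVec_mulVec]
  rfl

theorem liftD_mulVec_stack [Fintype i] (h : ℕ) (A : Matrix n n ℝ) (B : Matrix n i ℝ)
    (C : Matrix o n ℝ) (D : Matrix o i ℝ) (u : ℕ → i → ℝ) :
    liftD h A B C D *ᵥ stack h u = stack h fun j =>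
      D *ᵥ u j + C *ᵥ ∑ k ∈ Finset.range j, A ^ (j - 1 - k) *ᵥ (B *ᵥ u k) := by
  funext ⟨j, a⟩
  have hterm : ∀ k : Fin h, ∑ b, liftD h A B C D (j, a) (k, b) * u k b =
      (if k = j then (D *ᵥ u j) a else 0) +
        if (k : ℕ) < j then (C *ᵥ (A ^ ((j : ℕ) - 1 - k) *ᵥ (B *ᵥ u k))) a else 0 := by
    intro k
    rcases lt_trichotomy k j with hk | hk | hk
    · have h1 : ((j : ℕ) - 1 - k) = j - k - 1 := by omega
      have h2 : (k : ℕ) < j := hk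
      simp only [liftD, of_apply, hk.ne, hk.ne', hk, h2, if_true, if_false, zero_add, h1,
        mulVec_mulVec, ← Matrix.mul_assoc]
      rfl
    · subst hk
      simp [liftD, mulVec, dotProduct]
    · have h2 : ¬ (k : ℕ) < j := not_lt.2 (le_of_lt hk)
      simp [liftD, hk.ne, hk.ne', hk.not_gt, h2]
  have hsum : (C *ᵥ ∑ k ∈ Finset.range j, A ^ ((j : ℕ) - 1 - k) *ᵥ (B *ᵥ u k)) a =
      ∑ k : Fin h, if (k : ℕ) < j then (C *ᵥ (A ^ ((j : ℕ) - 1 - k) *ᵥ (B *ᵥ u k))) a else 0 := by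
    rw [mulVec_sum, Finset.sum_apply,
      Fin.sum_univ_eq_sum_range (fun k : ℕ =>
        if k < (j : ℕ) then (C *ᵥ (A ^ ((j : ℕ) - 1 - k) *ᵥ (B *ᵥ u k))) a else 0) h,
      ← Finset.sum_filter]
    refine Finset.sum_congr ?_ fun _ _ => rfl
    ext k
    have := j.2
    simp only [Finset.mem_range, Finset.mem_filter]
    omega
  calc (liftD h A B C D *ᵥ stack h u) (j, a)
      = ∑ k : Fin h, ∑ b, liftD h A B C D (j, a) (k, b) * u k b := by
        rw [mulVec, dotProduct, Fintype.sum_prod_type]; rfl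
    _ = (D *ᵥ u j) a + (C *ᵥ ∑ k ∈ Finset.range j, A ^ ((j : ℕ) - 1 - k) *ᵥ (B *ᵥ u k)) a := by
        rw [Finset.sum_congr rfl fun k _ => hterm k, Finset.sum_add_distrib, hsum]
        simp

theorem liftB_fromCols_mulVec_stack {i' : Type*} [Fintype i] [Fintype i'] (h : ℕ)
    (A : Matrix n n ℝ) (B : Matrix n i ℝ) (B' : Matrix n i' ℝ) (u : ℕ → i → ℝ)
    (u' : ℕ → i' → ℝ) :
    liftB h A (fromCols B B') *ᵥ stack h (fun k => Sum.elim (u k) (u' k)) =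
      liftB h A B *ᵥ stack h u + liftB h A B' *ᵥ stack h u' := by
  simp only [liftB_mulVec_stack, fromCols_mulVec_sumElim, mulVec_add, Finset.sum_add_distrib]

theorem liftD_fromCols_mulVec_stack {i' : Type*} [Fintype i] [Fintype i'] (h : ℕ)
    (A : Matrix n n ℝ) (B : Matrix n i ℝ) (B' : Matrix n i' ℝ) (C : Matrix o n ℝ)
    (D : Matrix o i ℝ) (D' : Matrix o i' ℝ) (u : ℕ → i → ℝ) (u' : ℕ → i' → ℝ) :
    liftD h A (fromCols B B') C (fromCols D D') *ᵥ stack h (fun k => Sum.elim (u k) (u' k)) =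
      liftD h A B C D *ᵥ stack h u + liftD h A B' C D' *ᵥ stack h u' := by
  simp only [liftD_mulVec_stack, fromCols_mulVec_sumElim, mulVec_add, Finset.sum_add_distrib]
  funext p
  simp only [stack, Pi.add_apply]
  ring

/-- Variation of constants; the subtraction `j - 1 - k` is never truncated because `k < j` in the
sum. -/
theorem state_eq_sum {h : ℕ} {A : Matrix n n ℝ} {x f : ℕ → n → ℝ}
    (hx : ∀ k < h, x (k + 1) = A *ᵥ x k + f k) :
    ∀ j ≤ h, x j = A ^ j *ᵥ x 0 + ∑ k ∈ Finset.range j, A ^ (j - 1 - k) *ᵥ f k := by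
  intro j
  induction j with
  | zero => simp
  | succ j ih =>
    intro hj
    rw [hx j (by omega), ih (by omega), mulVec_add, mulVec_mulVec, ← pow_succ',
      Finset.sum_range_succ, mulVec_sum, add_assoc]
    congr 2
    · refine Finset.sum_congr rfl fun k hk => ?_
      rw [mulVec_mulVec, ← pow_succ']
      congr 2
      have := Finset.mem_range.1 hk
      omega
    · simp

variable {i₁ i₂ i₃ : Type*} [Fintype i₁] [Fintype i₂] [Fintype i₃]
  {h : ℕ} {A : Matrix n n ℝ} {B₁ : Matrix n i₁ ℝ} {B₂ : Matrix n i₂ ℝ} {B₃ : Matrix n i₃ ℝ}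
  {x : ℕ → n → ℝ} {u₁ : ℕ → i₁ → ℝ} {u₂ : ℕ → i₂ → ℝ} {u₃ : ℕ → i₃ → ℝ}

theorem state_eq_lift
    (hx : ∀ k < h, x (k + 1) = A *ᵥ x k + B₁ *ᵥ u₁ k + B₂ *ᵥ u₂ k + B₃ *ᵥ u₃ k) :
    x h = A ^ h *ᵥ x 0 + liftB h A B₁ *ᵥ stack h u₁ + liftB h A B₂ *ᵥ stack h u₂ +
      liftB h A B₃ *ᵥ stack h u₃ := by
  rw [state_eq_sum (A := A) (x := x) (f := fun k => B₁ *ᵥ u₁ k + B₂ *ᵥ u₂ k + B₃ *ᵥ u₃ k)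
    (fun k hk => by rw [hx k hk]; abel) h le_rfl]
  simp only [liftB_mulVec_stack, mulVec_add, Finset.sum_add_distrib]
  abel

theorem output_eq_lift {C : Matrix o n ℝ} {D₁ : Matrix o i₁ ℝ} {D₂ : Matrix o i₂ ℝ}
    {D₃ : Matrix o i₃ ℝ} {y : ℕ → o → ℝ}
    (hx : ∀ k < h, x (k + 1) = A *ᵥ x k + B₁ *ᵥ u₁ k + B₂ *ᵥ u₂ k + B₃ *ᵥ u₃ k)
    (hy : ∀ k < h, y k = C *ᵥ x k + D₁ *ᵥ u₁ k + D₂ *ᵥ u₂ k + D₃ *ᵥ u₃ k) :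
    stack h y = liftC h A C *ᵥ x 0 + liftD h A B₁ C D₁ *ᵥ stack h u₁ +
      liftD h A B₂ C D₂ *ᵥ stack h u₂ + liftD h A B₃ C D₃ *ᵥ stack h u₃ := by
  funext ⟨j, a⟩
  have hs := state_eq_sum (A := A) (x := x) (f := fun k => B₁ *ᵥ u₁ k + B₂ *ᵥ u₂ k + B₃ *ᵥ u₃ k)
    (fun k hk => by rw [hx k hk]; abel) j j.2.le
  have hyj := hy j j.2
  rw [hs] at hyj
  simp only [liftC_mulVec, liftD_mulVec_stack, Pi.add_apply, stack]
  rw [hyj]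
  simp only [mulVec_add, Finset.sum_add_distrib, Pi.add_apply]
  ring

end Lifting

theorem padCols_mulVec_stack {m i : Type*} [Fintype i] {σ h : ℕ} (hσ : σ ≤ h)
    (M : Matrix m (Fin σ × i) ℝ) (u : ℕ → i → ℝ) :
    padCols h M *ᵥ stack h u = M *ᵥ stack σ u := by
  funext a
  simp only [mulVec, dotProduct, Fintype.sum_prod_type, padCols, of_apply, stack]
  have h1 := Fin.sum_univ_eq_sum_range (fun k : ℕ => ∑ b, (if hj : k < σ then M a (⟨k, hj⟩, b)
    else 0) * u k b) h
  have h2 := Fin.sum_univ_eq_sum_range (fun k : ℕ => ∑ b, (if hj : k < σ then M a (⟨k, hj⟩, b)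
    else 0) * u k b) σ
  simp only [Fin.is_lt, dite_true] at h2
  rw [h1, h2]
  symm
  refine Finset.sum_subset (Finset.range_mono hσ) fun k _ hk => ?_
  have : ¬ k < σ := by simpa using hk
  simp [this]

theorem selectFirst_mulVec_stack {z : Type*} [Fintype z] [DecidableEq z] {σ h : ℕ} (hσ : σ ≤ h)
    (u : ℕ → z → ℝ) : selectFirst σ h z *ᵥ stack h u = stack σ u := by
  rw [selectFirst, padCols_mulVec_stack hσ, one_mulVec]

/-- The vector `v - D⁺ D v` lies in `ker D`, hence in `ker M`. Thus `M v` can be recovered from `D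
v` even though `v` cannot. -/
theorem mul_moorePenroseInverse_mulVec {l m n : Type*} [Fintype m] [Fintype n]
    {D : Matrix m n ℝ} {M : Matrix l n ℝ}
    (hker : LinearMap.ker D.mulVecLin ≤ LinearMap.ker M.mulVecLin) (v : n → ℝ) :
    (M * moorePenroseInverse D) *ᵥ (D *ᵥ v) = M *ᵥ v := by
  have h1 : v - moorePenroseInverse D *ᵥ (D *ᵥ v) ∈ LinearMap.ker D.mulVecLin := by
    rw [LinearMap.mem_ker, mulVecLin_apply, mulVec_sub, mulVec_mulVec, mulVec_mulVec,
      (moorePenroseInverse_spec D).mul_mul_self, sub_self]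
  have h2 := hker h1
  rw [LinearMap.mem_ker, mulVecLin_apply, mulVec_sub, sub_eq_zero] at h2
  rw [← mulVec_mulVec, ← h2]

/-! ### The data-dependent multipliers -/

namespace LFR

variable {nx nw nn nr nz ne ny : ℕ} {G : LFR nx nw nn nr nz ne ny}

/-- With `u = -(D̂_znᵀ a + D̂_ynᵀ b)`, the second component of `T (a, b)` is always `u`. The
hypothesis `hab` says that the scalar first component equals `-n_*ᵀ u`, which is the form needed by
the noise multiplier. -/
theorem data_mulVec {h : ℕ} {xs : Fin nx → ℝ} {ns : Fin h × Fin nn → ℝ}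
    {rs : Fin h × Fin nr → ℝ} {ys : Fin h × Fin ny → ℝ} {a : Fin h × Fin nz → ℝ}
    {b : Fin h × Fin ny → ℝ}
    (hab : b ⬝ᵥ ys - b ⬝ᵥ (G.hCy h *ᵥ xs + G.hDyn h *ᵥ ns + G.hDyr h *ᵥ rs) =
      a ⬝ᵥ (G.hCz h *ᵥ xs + G.hDzn h *ᵥ ns + G.hDzr h *ᵥ rs)) :
    ((dataMatrix (nn := nn) h xs rs ys)ᵀ * G.dataOuterFactor h) *ᵥ Sum.elim a b =
      Sum.elim (-((replicateCol Unit ns)ᵀ *ᵥ (-((G.hDzn h)ᵀ *ᵥ a + (G.hDyn h)ᵀ *ᵥ b))))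
        (-((G.hDzn h)ᵀ *ᵥ a + (G.hDyn h)ᵀ *ᵥ b)) := by
  have hcol : ∀ {ι : Type} [Fintype ι] (u v : ι → ℝ),
      (replicateCol Unit u)ᵀ *ᵥ v = fun _ => u ⬝ᵥ v := fun u v => rfl
  rw [← mulVec_mulVec]
  simp only [dataMatrix, dataOuterFactor, transpose_fromRows, transpose_fromCols, fromRows_mulVec,
    fromCols_mulVec_sumElim, hcol, transpose_zero, transpose_one, zero_mulVec, one_mulVec,
    neg_mulVec, zero_add]
  simp only [dotProduct_add, dotProduct_neg, dotProduct_transpose_mulVec] at hab ⊢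
  funext t
  rcases t with t | t
  · simp only [Sum.elim_inl, Pi.add_apply, Pi.neg_apply, dotProduct_comm ys b]
    simp
    linarith
  · simp
    ring

end LFR

theorem one_kronecker_transpose_mulVec_dotProduct {k m n : Type*} [Fintype k] [DecidableEq k]
    [Fintype m] [Fintype n] (M : Matrix m n ℝ) (v : k × m → ℝ) (u : k × n → ℝ) :
    (((1 : Matrix k k ℝ) ⊗ₖ Mᵀ) *ᵥ v) ⬝ᵥ u = v ⬝ᵥ ((1 : Matrix k k ℝ) ⊗ₖ M) *ᵥ u := by
  have h : (1 : Matrix k k ℝ) ⊗ₖ Mᵀ = ((1 : Matrix k k ℝ) ⊗ₖ M)ᵀ := by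
    rw [← kroneckerMap_transpose, transpose_one]
  rw [h, dotProduct_comm, dotProduct_transpose_mulVec]

theorem Matrix.PosDef.inv_form {m : Type*} [Fintype m] [DecidableEq m] {X : Matrix m m ℝ}
    (hX : X.PosDef) (v : m → ℝ) :
    (X⁻¹ *ᵥ v) ⬝ᵥ X *ᵥ (X⁻¹ *ᵥ v) = v ⬝ᵥ X⁻¹ *ᵥ v ∧ (X⁻¹ *ᵥ v) ⬝ᵥ v = v ⬝ᵥ X⁻¹ *ᵥ v := by
  have hdet : IsUnit X.det := (isUnit_iff_isUnit_det X).1 hX.isUnit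
  rw [mulVec_mulVec, mul_nonsing_inv _ hdet, one_mulVec]
  exact ⟨dotProduct_comm _ _, dotProduct_comm _ _⟩

/-- The sequence with the given first `h` values, continued by zero. -/
def unstack {ι : Type*} {h : ℕ} (v : Fin h × ι → ℝ) : ℕ → ι → ℝ :=
  fun k => if hk : k < h then fun i => v (⟨k, hk⟩, i) else 0

theorem unstack_apply {ι : Type*} {h : ℕ} (v : Fin h × ι → ℝ) {k : ℕ} (hk : k < h) :
    unstack v k = fun i => v (⟨k, hk⟩, i) := by simp [unstack, hk]

theorem stack_unstack {ι : Type*} {h : ℕ} (v : Fin h × ι → ℝ) : stack h (unstack v) = v := by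
  funext p
  simp [stack, unstack]

theorem stack_congr {ι : Type*} {h : ℕ} {u v : ℕ → ι → ℝ} (huv : ∀ k < h, u k = v k) :
    stack h u = stack h v := by
  funext p
  rw [stack, huv p.1 p.1.2, stack]

/-! ### Duality pairings and the sign of the data term -/

namespace LFR

variable {nx nw nn nr nz ne ny : ℕ} {G : LFR nx nw nn nr nz ne ny}

theorem adjointState_dotProduct {σ : ℕ} (p : Fin nx → ℝ) (q : Fin σ × Fin nz → ℝ)
    (s : Fin σ × Fin ne → ℝ) (x : Fin nx → ℝ) :
    G.adjointState σ p q s ⬝ᵥ x =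
      p ⬝ᵥ G.A ^ σ *ᵥ x + (q ⬝ᵥ G.hCz σ *ᵥ x + s ⬝ᵥ G.hCe σ *ᵥ x) := by
  rw [dotProduct_comm]
  simp only [adjointState, dotProduct_add, dotProduct_transpose_mulVec]

theorem adjointUncertainty_dotProduct {σ : ℕ} (p : Fin nx → ℝ) (q : Fin σ × Fin nz → ℝ)
    (s : Fin σ × Fin ne → ℝ) (w : Fin σ × Fin nw → ℝ) :
    G.adjointUncertainty σ p q s ⬝ᵥ w =
      p ⬝ᵥ G.hBw σ *ᵥ w + (q ⬝ᵥ G.hDzw σ *ᵥ w + s ⬝ᵥ G.hDew σ *ᵥ w) := by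
  rw [dotProduct_comm]
  simp only [adjointUncertainty, dotProduct_add, dotProduct_transpose_mulVec]

theorem adjointDisturbance_dotProduct {σ : ℕ} (p : Fin nx → ℝ) (q : Fin σ × Fin nz → ℝ)
    (s : Fin σ × Fin ne → ℝ) (d : Fin σ × (Fin nn ⊕ Fin nr) → ℝ) :
    G.adjointDisturbance σ p q s ⬝ᵥ d =
      p ⬝ᵥ G.hBd σ *ᵥ d + (q ⬝ᵥ G.hDzd σ *ᵥ d + s ⬝ᵥ G.hDed σ *ᵥ d) := by
  rw [dotProduct_comm]
  simp only [adjointDisturbance, dotProduct_add, dotProduct_transpose_mulVec]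

/-- `(p, q, s)` is compatible with the adjoint uncertainty `Δᵀ`. -/
def IsAdjointTriple (G : LFR nx nw nn nr nz ne ny) (Δ : Matrix (Fin nw) (Fin nz) ℝ) (σ : ℕ)
    (p : Fin nx → ℝ) (q : Fin σ × Fin nz → ℝ) (s : Fin σ × Fin ne → ℝ) : Prop :=
  q = ((1 : Matrix (Fin σ) (Fin σ) ℝ) ⊗ₖ Δᵀ) *ᵥ G.adjointUncertainty σ p q s

/-- Moving `Δᵀ` across the pairing replaces `q · z` by `v · w`, where `v` is the adjoint output on
the channel of `w`. -/
theorem IsAdjointTriple.dotProduct_stack {Δ : Matrix (Fin nw) (Fin nz) ℝ} {σ : ℕ}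
    {p : Fin nx → ℝ} {q : Fin σ × Fin nz → ℝ} {s : Fin σ × Fin ne → ℝ}
    (hq : G.IsAdjointTriple Δ σ p q s) {w : ℕ → Fin nw → ℝ} {z : ℕ → Fin nz → ℝ}
    (hw : ∀ k < σ, w k = Δ *ᵥ z k) :
    q ⬝ᵥ stack σ z = p ⬝ᵥ G.hBw σ *ᵥ stack σ w +
      (q ⬝ᵥ G.hDzw σ *ᵥ stack σ w + s ⬝ᵥ G.hDew σ *ᵥ stack σ w) := by
  rw [← adjointUncertainty_dotProduct]
  conv_lhs => rw [show q = _ from hq]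
  rw [one_kronecker_transpose_mulVec_dotProduct, one_kronecker_mulVec_stack, ← stack_congr hw]

/-- The unknown `w` of the experiment enters the measurement only through `D̂_hyw w`, from which
`M_b` and `M_d` recover its effect on state and error over the first `σ` steps. The adjoint loop
equation then provides the hypothesis of `data_mulVec`. -/
theorem data_form_nonpos {Δ : Matrix (Fin nw) (Fin nz) ℝ} {h σ : ℕ} {xs : Fin nx → ℝ}
    {ns : Fin h × Fin nn → ℝ} {rs : Fin h × Fin nr → ℝ} {ys : Fin h × Fin ny → ℝ}
    (hdata : Δ ∈ G.compatibleUncertainties h xs ns rs ys)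
    {Pns : Set (Matrix (Unit ⊕ (Fin h × Fin nn)) (Unit ⊕ (Fin h × Fin nn)) ℝ)}
    (hPns : IsMultiplierSet {replicateCol Unit ns} Pns)
    (hσh : σ ≤ h) (hker : G.KernelInclusion h σ)
    {PD : Matrix ((Fin h × Fin nz) ⊕ (Fin h × Fin ny)) ((Fin h × Fin nz) ⊕ (Fin h × Fin ny)) ℝ}
    (hPD : PD ∈ G.dataMultiplierSet h xs rs ys Pns)
    {p : Fin nx → ℝ} {q : Fin σ × Fin nz → ℝ} {s : Fin σ × Fin ne → ℝ}
    (hq : G.IsAdjointTriple Δ σ p q s) :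
    Sum.elim ((selectFirst σ h (Fin nz))ᵀ *ᵥ q) ((G.Mb h σ)ᵀ *ᵥ p + (G.Md h σ)ᵀ *ᵥ s) ⬝ᵥ
        PD *ᵥ Sum.elim ((selectFirst σ h (Fin nz))ᵀ *ᵥ q)
          ((G.Mb h σ)ᵀ *ᵥ p + (G.Md h σ)ᵀ *ᵥ s) ≤ 0 := by
  obtain ⟨Pn, hPn, hPD⟩ := hPD
  have hPD' : PD = symProduct Pn
    ((dataMatrix (nn := nn) h xs rs ys)ᵀ * G.dataOuterFactor h) := hPD
  obtain ⟨x, w, z, e, rfl, hsol⟩ := hdata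
  have hx : ∀ k < h, x (k + 1) =
      G.A *ᵥ x k + G.Bw *ᵥ w k + G.Bn *ᵥ unstack ns k + G.Br *ᵥ unstack rs k := fun k hk => by
    rw [unstack_apply ns hk, unstack_apply rs hk]
    exact (hsol ⟨k, hk⟩).1
  have hz := output_eq_lift hx (y := z) (C := G.Cz) (D₁ := G.Dzw) (D₂ := G.Dzn) (D₃ := G.Dzr)
    fun k hk => by
      rw [unstack_apply ns hk, unstack_apply rs hk]
      exact (hsol ⟨k, hk⟩).2.1
  have hy := output_eq_lift hx (y := unstack ys) (C := G.Cy) (D₁ := G.Dyw) (D₂ := G.Dyn)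
    (D₃ := G.Dyr) fun k hk => by
      rw [unstack_apply ns hk, unstack_apply rs hk, unstack_apply ys hk]
      exact (hsol ⟨k, hk⟩).2.2.2.1
  rw [stack_unstack, stack_unstack] at hz hy
  rw [stack_unstack] at hy
  have hpair := hq.dotProduct_stack (w := w) (z := z)
    fun k hk => (hsol ⟨k, hk.trans_le hσh⟩).2.2.2.2
  have hNz : selectFirst σ h (Fin nz) *ᵥ stack h z = stack σ z := selectFirst_mulVec_stack hσh z
  -- Causality: the first `σ` outputs depend only on the first `σ` inputs.
  have hND : selectFirst σ h (Fin nz) *ᵥ (G.hDzw h *ᵥ stack h w) = G.hDzw σ *ᵥ stack σ w := by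
    rw [hDzw, hDzw, liftD_mulVec_stack, liftD_mulVec_stack, selectFirst_mulVec_stack hσh]
  have hMb : G.Mb h σ *ᵥ (G.hDyw h *ᵥ stack h w) = G.hBw σ *ᵥ stack σ w := by
    rw [Mb, mul_moorePenroseInverse_mulVec hker.1, padCols_mulVec_stack hσh]
  have hMd : G.Md h σ *ᵥ (G.hDyw h *ᵥ stack h w) = G.hDew σ *ᵥ stack σ w := by
    rw [Md, mul_moorePenroseInverse_mulVec hker.2, padCols_mulVec_stack hσh]
  have hT := data_mulVec (G := G) (xs := x 0) (ns := ns) (rs := rs) (ys := ys)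
    (a := (selectFirst σ h (Fin nz))ᵀ *ᵥ q) (b := (G.Mb h σ)ᵀ *ᵥ p + (G.Md h σ)ᵀ *ᵥ s) (by
      have h1 : ys - (G.hCy h *ᵥ x 0 + G.hDyn h *ᵥ ns + G.hDyr h *ᵥ rs) =
          G.hDyw h *ᵥ stack h w := by
        rw [hy, hCy, hDyn, hDyr, hDyw]
        abel
      have h2 : G.hCz h *ᵥ x 0 + G.hDzn h *ᵥ ns + G.hDzr h *ᵥ rs =
          stack h z - G.hDzw h *ᵥ stack h w := by
        rw [hz, hCz, hDzn, hDzr, hDzw]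
        abel
      rw [← dotProduct_sub, h1, h2, dotProduct_comm, dotProduct_add, dotProduct_transpose_mulVec,
        dotProduct_transpose_mulVec, hMb, hMd, dotProduct_comm (_ᵀ *ᵥ q), dotProduct_transpose_mulVec,
        mulVec_sub, hNz, hND, dotProduct_sub, hpair]
      ring)
  rw [hPD', symProduct_form, hT]
  exact form_nonpos_of_dual_multiplier (hPns.2.1 _ rfl Pn hPn) _

/-- The dissipation inequality of the adjoint system on a block of length `σ`. -/
def AdjointDissipation (G : LFR nx nw nn nr nz ne ny) (Δ : Matrix (Fin nw) (Fin nz) ℝ) (σ : ℕ)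
    (γ c : ℝ) (X : Matrix (Fin nx) (Fin nx) ℝ) : Prop :=
  ∀ p q s, G.IsAdjointTriple Δ σ p q s →
    c * (p ⬝ᵥ p + (q ⬝ᵥ q + s ⬝ᵥ s)) +
      (G.adjointState σ p q s ⬝ᵥ X *ᵥ G.adjointState σ p q s +
        (γ ^ 2)⁻¹ * (G.adjointDisturbance σ p q s ⬝ᵥ G.adjointDisturbance σ p q s)) ≤
      p ⬝ᵥ X *ᵥ p + s ⬝ᵥ s

/-! ### Solvability of the adjoint loop and well-posedness -/

section Adjoint

variable {Δ : Matrix (Fin nw) (Fin nz) ℝ} {σ : ℕ} {γ c : ℝ} {X : Matrix (Fin nx) (Fin nx) ℝ}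

/-- For `p = 0` and `s = 0` the supply vanishes, so the margin `c (q ⬝ᵥ q)` must be zero. -/
theorem AdjointDissipation.eq_zero (hG : G.AdjointDissipation Δ σ γ c X) (hX : X.PosDef)
    (hc : 0 < c) {q : Fin σ × Fin nz → ℝ}
    (hq : q = ((1 : Matrix (Fin σ) (Fin σ) ℝ) ⊗ₖ Δᵀ) *ᵥ ((G.hDzw σ)ᵀ *ᵥ q)) : q = 0 := by
  have hq' : G.IsAdjointTriple Δ σ 0 q 0 := by
    simpa [IsAdjointTriple, adjointUncertainty] using hq
  have h1 := hG 0 q 0 hq'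
  have h2 : 0 ≤ G.adjointState σ 0 q 0 ⬝ᵥ X *ᵥ G.adjointState σ 0 q 0 := by
    simpa using hX.posSemidef.dotProduct_mulVec_nonneg (G.adjointState σ 0 q 0)
  have h3 := dotProduct_self_nonneg_real (G.adjointDisturbance σ 0 q 0)
  have h4 := dotProduct_self_nonneg_real q
  have h5 : 0 ≤ (γ ^ 2)⁻¹ *
    (G.adjointDisturbance σ 0 q 0 ⬝ᵥ G.adjointDisturbance σ 0 q 0) := by positivity
  simp only [dotProduct_zero, zero_add, add_zero, mulVec_zero] at h1
  have h6 : q ⬝ᵥ q = 0 := by nlinarith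
  exact dotProduct_self_eq_zero.1 h6

/-- The loop equation is a square linear system in `q`, injective by `AdjointDissipation.eq_zero`
and hence surjective. -/
theorem AdjointDissipation.exists_isAdjointTriple (hG : G.AdjointDissipation Δ σ γ c X)
    (hX : X.PosDef) (hc : 0 < c) (p : Fin nx → ℝ) (s : Fin σ × Fin ne → ℝ) :
    ∃ q, G.IsAdjointTriple Δ σ p q s := by
  obtain ⟨K, hK⟩ : ∃ K, K = (1 : Matrix (Fin σ) (Fin σ) ℝ) ⊗ₖ Δᵀ := ⟨_, rfl⟩
  have hinj : Function.Injective ((1 : Matrix (Fin σ × Fin nz) (Fin σ × Fin nz) ℝ) -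
      K * (G.hDzw σ)ᵀ).mulVecLin := by
    rw [← LinearMap.ker_eq_bot, LinearMap.ker_eq_bot']
    intro q hq
    refine hG.eq_zero hX hc ?_
    rw [mulVecLin_apply, sub_mulVec, one_mulVec, sub_eq_zero, ← mulVec_mulVec, hK] at hq
    exact hq
  obtain ⟨q, hq⟩ := LinearMap.injective_iff_surjective.1 hinj
    (K *ᵥ ((G.hBw σ)ᵀ *ᵥ p + (G.hDew σ)ᵀ *ᵥ s))
  refine ⟨q, ?_⟩
  rw [mulVecLin_apply, sub_mulVec, one_mulVec, sub_eq_iff_eq_add, ← mulVec_mulVec,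
    ← mulVec_add] at hq
  rw [IsAdjointTriple, ← hK, adjointUncertainty]
  refine hq.trans ?_
  congr 1
  abel

theorem AdjointDissipation.isUnit (hG : G.AdjointDissipation Δ σ γ c X) (hX : X.PosDef)
    (hc : 0 < c) (hσ : 1 ≤ σ) : IsUnit (1 - G.Dzw * Δ) := by
  rw [← vecMul_injective_iff_isUnit, ← coe_vecMulLinear, ← LinearMap.ker_eq_bot,
    LinearMap.ker_eq_bot']
  intro v hv
  have hv' : v = Δᵀ *ᵥ (G.Dzwᵀ *ᵥ v) := by
    rw [vecMulLinear_apply, vecMul_sub, vecMul_one, sub_eq_zero, ← vecMul_vecMul] at hv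
    rw [mulVec_transpose, mulVec_transpose]
    exact hv
  have hσ0 : 0 < σ := hσ
  -- The transpose of `D̂_zw` is block upper triangular, so a vector supported in block 0 stays
  -- there. A left kernel vector of `1 - D_zw Δ` therefore lifts to a solution of the homogeneous
  -- adjoint loop.
  have hD : (G.hDzw σ)ᵀ *ᵥ stack σ (fun k => if k = 0 then v else 0) =
      stack σ (fun k => if k = 0 then G.Dzwᵀ *ᵥ v else 0) := by
    funext ⟨j, b⟩
    rw [mulVec, dotProduct, Fintype.sum_prod_type, Finset.sum_eq_single ⟨0, hσ0⟩]
    · by_cases hj : j = ⟨0, hσ0⟩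
      · subst hj
        simp [hDzw, liftD, stack, mulVec, dotProduct]
      · have hj0 : (j : ℕ) ≠ 0 := fun h => hj (Fin.ext h)
        have hj1 : ¬ j < ⟨0, hσ0⟩ := by simp [Fin.lt_def]
        simp [hDzw, liftD, stack, hj0, Ne.symm hj, hj1]
    · intro k _ hk
      have hk0 : (k : ℕ) ≠ 0 := fun h => hk (Fin.ext h)
      simp [stack, hk0]
    · simp
  have hq := hG.eq_zero hX hc (q := stack σ fun k => if k = 0 then v else 0) (by
    rw [hD, one_kronecker_mulVec_stack]
    refine stack_congr fun k _ => ?_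
    by_cases hk : k = 0
    · simpa [hk] using hv'
    · simp [hk])
  funext a
  have := congrFun hq (⟨0, hσ0⟩, a)
  simpa [stack] using this

end Adjoint

/-! ### From the adjoint to the primal dissipation inequality -/

section Primal

variable {Δ : Matrix (Fin nw) (Fin nz) ℝ} {σ : ℕ} {γ c : ℝ} {X : Matrix (Fin nx) (Fin nx) ℝ}
  {x : ℕ → Fin nx → ℝ} {w : ℕ → Fin nw → ℝ} {z : ℕ → Fin nz → ℝ} {n : ℕ → Fin nn → ℝ}
  {r : ℕ → Fin nr → ℝ} {e : ℕ → Fin ne → ℝ} {y : ℕ → Fin ny → ℝ}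

theorem IsTrajectory.shift (hT : G.IsTrajectory Δ x w z n r e y) (t : ℕ) :
    G.IsTrajectory Δ (fun k => x (t + k)) (fun k => w (t + k)) (fun k => z (t + k))
      (fun k => n (t + k)) (fun k => r (t + k)) (fun k => e (t + k)) (fun k => y (t + k)) :=
  fun k => hT (t + k)

/-- This is Green's identity for the lifted system: the contributions of `w` and `z` cancel by
`IsAdjointTriple.dotProduct_stack`. -/
theorem IsTrajectory.pairing (hT : G.IsTrajectory Δ x w z n r e y)
    {p : Fin nx → ℝ} {q : Fin σ × Fin nz → ℝ} {s : Fin σ × Fin ne → ℝ}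
    (hq : G.IsAdjointTriple Δ σ p q s) :
    G.adjointState σ p q s ⬝ᵥ x 0 +
      G.adjointDisturbance σ p q s ⬝ᵥ stack σ (genDisturbance n r) =
      p ⬝ᵥ x σ + s ⬝ᵥ stack σ e := by
  have hx := fun k (_ : k < σ) => (hT k).1
  have hz := output_eq_lift hx fun k _ => (hT k).2.1
  have he := output_eq_lift hx fun k _ => (hT k).2.2.1
  have hB := liftB_fromCols_mulVec_stack σ G.A G.Bn G.Br n r
  have hDz := liftD_fromCols_mulVec_stack σ G.A G.Bn G.Br G.Cz G.Dzn G.Dzr n r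
  have hDe := liftD_fromCols_mulVec_stack σ G.A G.Bn G.Br G.Ce G.Den G.Der n r
  have hpair := hq.dotProduct_stack (w := w) (z := z) fun k _ => (hT k).2.2.2.2
  have h1 : G.hBd σ *ᵥ stack σ (genDisturbance n r) = _ := hB
  have h2 : G.hDzd σ *ᵥ stack σ (genDisturbance n r) = _ := hDz
  have h3 : G.hDed σ *ᵥ stack σ (genDisturbance n r) = _ := hDe
  rw [adjointState_dotProduct, adjointDisturbance_dotProduct, h1, h2, h3, he, state_eq_lift hx]
  rw [hz] at hpair
  simp only [dotProduct_add, hCz, hCe, hBw, hDzw, hDew] at hpair ⊢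
  linarith

theorem AdjointDissipation.primal (hG : G.AdjointDissipation Δ σ γ c X) (hX : X.PosDef)
    (hc : 0 < c) (hγ : 0 < γ) (hT : G.IsTrajectory Δ x w z n r e y) :
    x σ ⬝ᵥ X⁻¹ *ᵥ x σ + ∑ k ∈ Finset.range σ, e k ⬝ᵥ e k ≤
      x 0 ⬝ᵥ X⁻¹ *ᵥ x 0 +
        γ ^ 2 * ∑ k ∈ Finset.range σ, genDisturbance n r k ⬝ᵥ genDisturbance n r k := by
  -- With this costate both the right side of the adjoint inequality and the pairing equal the
  -- storage at `x σ` plus the error energy.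
  obtain ⟨q, hq⟩ := hG.exists_isAdjointTriple hX hc (X⁻¹ *ᵥ x σ) (stack σ e)
  have hdual := hG _ _ _ hq
  have hpair := hT.pairing hq
  rw [(hX.inv_form _).1] at hdual
  rw [(hX.inv_form _).2] at hpair
  have h1 : 0 ≤ c * ((X⁻¹ *ᵥ x σ) ⬝ᵥ (X⁻¹ *ᵥ x σ) + (q ⬝ᵥ q + stack σ e ⬝ᵥ stack σ e)) :=
    mul_nonneg hc.le (add_nonneg (dotProduct_self_nonneg_real _)
      (add_nonneg (dotProduct_self_nonneg_real _) (dotProduct_self_nonneg_real _)))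
  have h2 := dual_le_primal hX hγ one_pos (by linarith) hpair
  rwa [one_mul, stack_dotProduct_stack, stack_dotProduct_stack] at h2

theorem AdjointDissipation.exists_contraction (hG : G.AdjointDissipation Δ σ γ c X)
    (hX : X.PosDef) (hc : 0 < c) (hγ : 0 < γ) :
    ∃ ρ, 0 < ρ ∧ ρ < 1 ∧ ∀ x w z e y, G.IsTrajectory Δ x w z 0 0 e y →
      x σ ⬝ᵥ X⁻¹ *ᵥ x σ ≤ ρ * (x 0 ⬝ᵥ X⁻¹ *ᵥ x 0) := by
  obtain ⟨C, hC, hXC⟩ := Matrix.exists_form_le X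
  -- Since `X ≤ C I`, the bound `ε ≤ c / C` lets the margin absorb the fraction `ε` of `pᵀ X p`; the
  -- cap 1/2 keeps `ρ = 1 - ε` positive.
  have hε : 0 < min (c / C) (1 / 2) := lt_min (div_pos hc hC) (by norm_num)
  have hε1 : min (c / C) (1 / 2) ≤ c / C := min_le_left _ _
  have hε2 : min (c / C) (1 / 2) ≤ 1 / 2 := min_le_right _ _
  generalize min (c / C) (1 / 2) = ε at *
  refine ⟨1 - ε, by linarith, by linarith, fun x w z e y hT => ?_⟩
  obtain ⟨q, hq⟩ := hG.exists_isAdjointTriple hX hc (X⁻¹ *ᵥ x σ) 0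
  have hdual := hG _ _ _ hq
  have hpair := hT.pairing hq
  have hp := hXC (X⁻¹ *ᵥ x σ)
  rw [(hX.inv_form _).1] at hdual hp
  rw [(hX.inv_form _).2, zero_dotProduct, add_zero] at hpair
  have h0 : stack σ (genDisturbance (0 : ℕ → Fin nn → ℝ) (0 : ℕ → Fin nr → ℝ)) = 0 := by
    funext ⟨k, a⟩
    rcases a with a | a <;> rfl
  have h1 : 0 ≤ c * (q ⬝ᵥ q) := mul_nonneg hc.le (dotProduct_self_nonneg_real _)
  have h2 : ε * (x σ ⬝ᵥ X⁻¹ *ᵥ x σ) ≤ c * ((X⁻¹ *ᵥ x σ) ⬝ᵥ (X⁻¹ *ᵥ x σ)) := by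
    calc ε * (x σ ⬝ᵥ X⁻¹ *ᵥ x σ) ≤ ε * (C * ((X⁻¹ *ᵥ x σ) ⬝ᵥ (X⁻¹ *ᵥ x σ))) := by gcongr
      _ = (ε * C) * ((X⁻¹ *ᵥ x σ) ⬝ᵥ (X⁻¹ *ᵥ x σ)) := by ring
      _ ≤ c * ((X⁻¹ *ᵥ x σ) ⬝ᵥ (X⁻¹ *ᵥ x σ)) :=
        mul_le_mul_of_nonneg_right ((le_div_iff₀ hC).1 hε1) (dotProduct_self_nonneg_real _)
  simp only [dotProduct_zero, add_zero] at hdual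
  have h3 := dual_le_primal hX hγ (ρ := 1 - ε) (by linarith) (by linarith) hpair
  rwa [h0, dotProduct_zero, mul_zero, add_zero] at h3

end Primal

end LFR

/-! ### Exponential decay and summation over blocks -/

/-- Split `t` into full blocks, which contract by `ρ`, and fewer than `σ` remaining steps, which
cost at most `K ^ σ`. Replacing the floor of `t / σ` by `t / σ` costs the factor `ρ⁻¹`. -/
theorem le_exp_of_block_contraction {v : ℕ → ℝ} {σ : ℕ} {ρ K : ℝ} (hσ : 1 ≤ σ) (hρ : 0 < ρ)
    (hρ1 : ρ < 1) (hK : 1 ≤ K) (hv : ∀ t, 0 ≤ v t) (hblock : ∀ t, v (t + σ) ≤ ρ * v t)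
    (hstep : ∀ t, v (t + 1) ≤ K * v t) (t : ℕ) :
    v t ≤ K ^ σ / ρ * Real.exp (Real.log ρ / σ * t) * v 0 := by
  have hK0 : 0 < K := one_pos.trans_le hK
  have hb : ∀ k, v (σ * k) ≤ ρ ^ k * v 0 := by
    intro k
    induction k with
    | zero => simp
    | succ k ih =>
      calc v (σ * (k + 1)) ≤ ρ * v (σ * k) := hblock _
        _ ≤ ρ * (ρ ^ k * v 0) := by gcongr
        _ = ρ ^ (k + 1) * v 0 := by ring
  have hs : ∀ t j, v (t + j) ≤ K ^ j * v t := by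
    intro t j
    induction j with
    | zero => simp
    | succ j ih =>
      calc v (t + (j + 1)) ≤ K * v (t + j) := hstep _
        _ ≤ K * (K ^ j * v t) := by gcongr
        _ = K ^ (j + 1) * v t := by ring
  have hlog : Real.log ρ < 0 := Real.log_neg hρ hρ1
  have hσ0 : (0 : ℝ) < σ := by exact_mod_cast hσ
  have hexp : ρ ^ (t / σ) ≤ ρ⁻¹ * Real.exp (Real.log ρ / σ * t) := by
    have h1 : ρ ^ (t / σ + 1) = Real.exp (((t / σ + 1 : ℕ) : ℝ) * Real.log ρ) := by
      rw [Real.exp_nat_mul, Real.exp_log hρ]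
    have h2 : (t : ℝ) ≤ σ * ((t / σ + 1 : ℕ) : ℝ) := by
      exact_mod_cast (Nat.lt_mul_div_succ t hσ).le
    have h3 : ρ ^ (t / σ + 1) ≤ Real.exp (Real.log ρ / σ * t) := by
      rw [h1, Real.exp_le_exp, div_mul_eq_mul_div, le_div_iff₀ hσ0]
      nlinarith
    rw [le_inv_mul_iff₀ hρ, ← pow_succ']
    exact h3
  have hdecomp : σ * (t / σ) + t % σ = t := Nat.div_add_mod t σ
  calc v t = v (σ * (t / σ) + t % σ) := by rw [hdecomp]
    _ ≤ K ^ (t % σ) * v (σ * (t / σ)) := hs _ _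
    _ ≤ K ^ σ * (ρ ^ (t / σ) * v 0) := by
      gcongr
      · exact hv _
      · exact (Nat.mod_lt _ hσ).le
      · exact hb _
    _ ≤ K ^ σ * (ρ⁻¹ * Real.exp (Real.log ρ / σ * t) * v 0) := by
      gcongr
      exact hv 0
    _ = K ^ σ / ρ * Real.exp (Real.log ρ / σ * t) * v 0 := by ring

/-- The summands are nonnegative, so bounding arbitrarily late partial sums suffices; here these
will be the multiples of `σ`. -/
theorem l2Norm_le_of_sum_le {ι κ : Type*} [Fintype ι] [Fintype κ] {e : ℕ → ι → ℝ}
    {d : ℕ → κ → ℝ} {γ : ℝ} (hγ : 0 ≤ γ)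
    (hsum : ∀ m, ∃ N ≥ m, ∑ k ∈ Finset.range N, e k ⬝ᵥ e k ≤
      γ ^ 2 * ∑ k ∈ Finset.range N, d k ⬝ᵥ d k) :
    l2Norm e ≤ ENNReal.ofReal γ * l2Norm d := by
  have h1 : ∑' k, ENNReal.ofReal (e k ⬝ᵥ e k) ≤
      ENNReal.ofReal γ ^ (2 : ℝ) * ∑' k, ENNReal.ofReal (d k ⬝ᵥ d k) := by
    refine ENNReal.tsum_le_of_sum_range_le fun m => ?_
    obtain ⟨N, hN, hle⟩ := hsum m
    calc ∑ k ∈ Finset.range m, ENNReal.ofReal (e k ⬝ᵥ e k)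
        ≤ ∑ k ∈ Finset.range N, ENNReal.ofReal (e k ⬝ᵥ e k) :=
          Finset.sum_le_sum_of_subset (Finset.range_mono hN)
      _ = ENNReal.ofReal (∑ k ∈ Finset.range N, e k ⬝ᵥ e k) :=
          (ENNReal.ofReal_sum_of_nonneg fun k _ => dotProduct_self_nonneg_real _).symm
      _ ≤ ENNReal.ofReal (γ ^ 2 * ∑ k ∈ Finset.range N, d k ⬝ᵥ d k) :=
          ENNReal.ofReal_le_ofReal hle
      _ = ENNReal.ofReal γ ^ (2 : ℝ) * ∑ k ∈ Finset.range N, ENNReal.ofReal (d k ⬝ᵥ d k) := by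
          rw [ENNReal.ofReal_mul (sq_nonneg γ), ENNReal.ofReal_pow hγ,
            ENNReal.ofReal_sum_of_nonneg fun k _ => dotProduct_self_nonneg_real _]
          norm_num
      _ ≤ ENNReal.ofReal γ ^ (2 : ℝ) * ∑' k, ENNReal.ofReal (d k ⬝ᵥ d k) := by
          gcongr
          exact ENNReal.sum_le_tsum _
  calc l2Norm e ≤ (ENNReal.ofReal γ ^ (2 : ℝ) * ∑' k, ENNReal.ofReal (d k ⬝ᵥ d k)) ^
        (1 / 2 : ℝ) := ENNReal.rpow_le_rpow h1 (by norm_num)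
    _ = ENNReal.ofReal γ * l2Norm d := by
      rw [ENNReal.mul_rpow_of_nonneg _ _ (by norm_num), ← ENNReal.rpow_mul, l2Norm]
      norm_num

/-! ### Exponential stability and energy gain -/

namespace LFR

variable {nx nw nn nr nz ne ny : ℕ} {G : LFR nx nw nn nr nz ne ny}
  {Δ : Matrix (Fin nw) (Fin nz) ℝ} {σ : ℕ} {γ c : ℝ} {X : Matrix (Fin nx) (Fin nx) ℝ}

theorem exists_closedLoop (hU : IsUnit (1 - G.Dzw * Δ)) :
    ∃ Ac : Matrix (Fin nx) (Fin nx) ℝ, ∀ x w z e y, G.IsTrajectory Δ x w z 0 0 e y →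
      ∀ t, x (t + 1) = Ac *ᵥ x t := by
  refine ⟨G.A + G.Bw * (Δ * ((1 - G.Dzw * Δ)⁻¹ * G.Cz)), fun x w z e y hT t => ?_⟩
  obtain ⟨hx, hz, -, -, hw⟩ := hT t
  simp only [Pi.zero_apply, mulVec_zero, add_zero] at hx hz
  have h1 : (1 - G.Dzw * Δ) *ᵥ z t = G.Cz *ᵥ x t := by
    rw [sub_mulVec, one_mulVec, ← mulVec_mulVec, ← hw, sub_eq_iff_eq_add]
    exact hz
  have h2 : z t = (1 - G.Dzw * Δ)⁻¹ *ᵥ (G.Cz *ᵥ x t) := by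
    rw [← h1, mulVec_mulVec, nonsing_inv_mul _ ((isUnit_iff_isUnit_det _).1 hU), one_mulVec]
  rw [hx, hw, h2, add_mulVec]
  simp only [mulVec_mulVec]

theorem AdjointDissipation.isStable (hG : G.AdjointDissipation Δ σ γ c X) (hX : X.PosDef)
    (hc : 0 < c) (hγ : 0 < γ) (hσ : 1 ≤ σ) : G.IsStable Δ := by
  have hU := hG.isUnit hX hc hσ
  refine ⟨hU, ?_⟩
  obtain ⟨ρ, hρ, hρ1, hcontr⟩ := hG.exists_contraction hX hc hγ
  obtain ⟨Ac, hAc⟩ := exists_closedLoop hU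
  obtain ⟨a, ha, hlow⟩ := hX.inv.exists_mul_dotProduct_le
  obtain ⟨b, hb, hup⟩ := Matrix.exists_form_le X⁻¹
  obtain ⟨C, hC, hstep⟩ := Matrix.exists_form_le (symProduct X⁻¹ Ac)
  have hσ0 : (0 : ℝ) < σ := by exact_mod_cast hσ
  have hlog : Real.log ρ < 0 := Real.log_neg hρ hρ1
  have hL : 0 < (C / a + 1) ^ σ / ρ * b / a := by positivity
  -- The storage `X⁻¹` lies between `a` and `b` times the squared norm, hence the factor `b / a`;
  -- the square root and the halved rate pass from squared norms to norms.
  refine ⟨√((C / a + 1) ^ σ / ρ * b / a), Real.sqrt_pos.2 hL, -(Real.log ρ / σ) / 2,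
    half_pos (neg_pos.2 (div_neg_of_neg_of_pos hlog hσ0)), fun x w z e y hT t => ?_⟩
  -- One step multiplies the storage by at most `C / a`; adding 1 ensures `K ≥ 1`.
  have hV := le_exp_of_block_contraction (v := fun t => x t ⬝ᵥ X⁻¹ *ᵥ x t) (K := C / a + 1)
    hσ hρ hρ1 (by have := div_pos hC ha; linarith)
    (fun t => by simpa using hX.inv.posSemidef.dotProduct_mulVec_nonneg (x t))
    (fun t => hcontr _ _ _ _ _ (hT.shift t)) (fun t => by
      have h1 := hstep (x t)
      rw [symProduct_form, ← hAc x w z e y hT t] at h1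
      have h2 : C * (x t ⬝ᵥ x t) ≤ C / a * (x t ⬝ᵥ X⁻¹ *ᵥ x t) := by
        rw [div_mul_eq_mul_div, le_div_iff₀ ha, mul_assoc, mul_comm _ a]
        exact mul_le_mul_of_nonneg_left (hlow _) hC.le
      have h3 : 0 ≤ x t ⬝ᵥ X⁻¹ *ᵥ x t := by
        simpa using hX.inv.posSemidef.dotProduct_mulVec_nonneg (x t)
      linarith) t
  have hnorm : ∀ v : Fin nx → ℝ, ‖WithLp.toLp 2 v‖ ^ 2 = v ⬝ᵥ v := by
    intro v
    rw [EuclideanSpace.real_norm_sq_eq]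
    simp [dotProduct, pow_two]
  refine (sq_le_sq₀ (norm_nonneg _) (by positivity)).1 ?_
  rw [mul_pow, mul_pow, Real.sq_sqrt hL.le, ← Real.exp_nat_mul, hnorm, hnorm]
  have hexp : ((2 : ℕ) : ℝ) * (-(-(Real.log ρ / σ) / 2) * t) = Real.log ρ / σ * t := by
    push_cast
    ring
  rw [hexp]
  have h4 : a * (x t ⬝ᵥ x t) ≤
      (C / a + 1) ^ σ / ρ * Real.exp (Real.log ρ / σ * t) * (b * (x 0 ⬝ᵥ x 0)) :=
    (hlow _).trans (hV.trans (mul_le_mul_of_nonneg_left (hup _) (by positivity)))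
  calc x t ⬝ᵥ x t ≤
      ((C / a + 1) ^ σ / ρ * Real.exp (Real.log ρ / σ * t) * (b * (x 0 ⬝ᵥ x 0))) / a := by
        rw [le_div_iff₀ ha, mul_comm]
        exact h4
    _ = _ := by ring

theorem AdjointDissipation.energyGain_le (hG : G.AdjointDissipation Δ σ γ c X) (hX : X.PosDef)
    (hc : 0 < c) (hγ : 0 < γ) (hσ : 1 ≤ σ) : G.energyGain Δ ≤ ENNReal.ofReal γ := by
  refine sSup_le ?_
  rintro _ ⟨x, w, z, n, r, e, y, hT, hx0, -, -, rfl⟩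
  refine ENNReal.div_le_of_le_mul (l2Norm_le_of_sum_le hγ.le fun m => ?_)
  -- The block inequalities telescope from `x 0 = 0`; the final storage is nonnegative and is
  -- dropped below.
  have hsum : ∀ m, x (σ * m) ⬝ᵥ X⁻¹ *ᵥ x (σ * m) + ∑ k ∈ Finset.range (σ * m), e k ⬝ᵥ e k ≤
      γ ^ 2 * ∑ k ∈ Finset.range (σ * m), genDisturbance n r k ⬝ᵥ genDisturbance n r k := by
    intro m
    induction m with
    | zero => simp [hx0]
    | succ m ih =>
      have h := hG.primal hX hc hγ (hT.shift (σ * m))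
      rw [mul_add, mul_one, Finset.sum_range_add, Finset.sum_range_add, mul_add]
      have h' : x (σ * m + σ) ⬝ᵥ X⁻¹ *ᵥ x (σ * m + σ) +
          ∑ k ∈ Finset.range σ, e (σ * m + k) ⬝ᵥ e (σ * m + k) ≤
          x (σ * m) ⬝ᵥ X⁻¹ *ᵥ x (σ * m) + γ ^ 2 * ∑ k ∈ Finset.range σ,
            genDisturbance n r (σ * m + k) ⬝ᵥ genDisturbance n r (σ * m + k) := h
      linarith
  refine ⟨σ * m, Nat.le_mul_of_pos_left m hσ, ?_⟩
  have h0 : 0 ≤ x (σ * m) ⬝ᵥ X⁻¹ *ᵥ x (σ * m) := by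
    simpa using hX.inv.posSemidef.dotProduct_mulVec_nonneg (x (σ * m))
  linarith [hsum m]

end LFR

/-! ### Assembly of the proof -/

theorem mainTheorem2 {nx nw nn nr nz ne ny : ℕ} (G : LFR nx nw nn nr nz ne ny)
    (Δs : Set (Matrix (Fin nw) (Fin nz) ℝ)) (Δstar : Matrix (Fin nw) (Fin nz) ℝ)
    (hΔ : Δstar ∈ Δs)
    (h : ℕ) (xs : Fin nx → ℝ) (ns : Fin h × Fin nn → ℝ) (rs : Fin h × Fin nr → ℝ)
    (ys : Fin h × Fin ny → ℝ)
    (hdata : Δstar ∈ G.compatibleUncertainties h xs ns rs ys)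
    (Ps : Set (Matrix (Fin nz ⊕ Fin nw) (Fin nz ⊕ Fin nw) ℝ)) (hPs : IsMultiplierSet Δs Ps)
    (Pns : Set (Matrix (Unit ⊕ (Fin h × Fin nn)) (Unit ⊕ (Fin h × Fin nn)) ℝ))
    (hPns : IsMultiplierSet {Matrix.replicateCol Unit ns} Pns)
    (σ : ℕ) (hσ1 : 1 ≤ σ) (hσh : σ ≤ h) (hker : G.KernelInclusion h σ)
    (γ : ℝ) (hγ : 0 < γ)
    (X : Matrix (Fin nx) (Fin nx) ℝ) (hX : X.PosDef)
    (P : Matrix (Fin nz ⊕ Fin nw) (Fin nz ⊕ Fin nw) ℝ) (hP : P ∈ Ps)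
    (PD : Matrix ((Fin h × Fin nz) ⊕ (Fin h × Fin ny)) ((Fin h × Fin nz) ⊕ (Fin h × Fin ny)) ℝ)
    (hPD : PD ∈ G.dataMultiplierSet h xs rs ys Pns)
    (hLMI : G.LiftedLMI h σ γ X P PD) :
    G.IsStable Δstar ∧ G.energyGain Δstar ≤ ENNReal.ofReal γ := by
  obtain ⟨c, hc, hform⟩ := hLMI.exists_form_le hγ.ne'
  have hG : G.AdjointDissipation Δstar σ γ c X := by
    intro p q s hq
    have h1 := hform p q s
    have h2 := LFR.data_form_nonpos hdata hPns hσh hker hPD hq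
    have h3 := liftMultiplier_form_nonpos (σ := σ) (hPs.2.1 _ hΔ P hP)
      (G.adjointUncertainty σ p q s)
    -- The loop equation identifies the argument of the multiplier form with the one in the LMI, so
    -- both terms can be dropped.
    rw [← show q = _ from hq] at h3
    linarith
  exact ⟨hG.isStable hX hc hγ hσ1, hG.energyGain_le hX hc hγ hσ1⟩
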